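/- Let $N\in\mathbb N$ and $u=(u_1,\dots,u_N)\in\mathbb Z^N$ with $u_1<\dots<u_N$, and let $\xi=\sum_{j=1}^N\delta_{u_j}$. Random walks. Under $\mathrm P_x$, $x\in\mathbb Z^N$, let $V=(V_1,\dots,V_N)$ consist of $N$ independent continuous-time simple symmetric random walks on $\mathbb Z$ with $V_j(0)=x_j$, i.e. càdlàg processes with independent increments and $\mathrm E[e^{iz(V_j(t)-V_j(s))}]=e^{(t-s)(\cos z-1)}$ for $0\le s\le t$, $z\in\mathbb C$. Write $\mathbb W_N=\{x\in\mathbb R^N:x_1<\dots<x_N\}$, $\tau=\inf\{t\ge0:V(t)\notin\mathbb W_N\}$ and $h(x)=\det_{1\le j,k\le N}[x_j^{k-1}]$. Noncolliding walk. Let $X=(X_1,\dots,X_N)$ be the càdlàg Markov process in $\mathbb Z^N\cap\mathbb W_N$ with $X(0)=u$ and transition probabilities $\frac{h(y)}{h(x)}\mathrm P_x(V(t)=y,\ \tau>t)$ (the Doob $h$-transform of $V$ absorbed on leaving $\mathbb W_N$). Let $\Xi(t)=\sum_{j=1}^N\delta_{X_j(t)}$, a process in the space of nonnegative integer-valued Radon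 measures on $\mathbb Z$, let $\mathbb E_\xi$ be its expectation, and let $\mathcal F(t)=\sigma(\Xi(s):0\le s\le t)$. The functions $\mathcal M_\xi^{u_k}$. For $f:\mathbb Z\to\mathbb C$, $t\ge0$, $x\in\mathbb Z$ put $\mathcal S[f(W)\,|\,(t,x)]=e^t\sum_{w\in\mathbb Z}I_{|w-x|}(-t)f(w)$, where $I_n(z)=(z/2)^n\sum_{\ell\ge0}\frac{(z/2)^{2\ell}}{\ell!\,\Gamma(n+\ell+1)}$ is the modified Bessel function of the first kind. For $1\le k\le N$ let $$\Phi_\xi^{u_k}(z)=\prod_{j\ne k}\frac{z-u_j}{u_k-u_j},\qquad \mathcal M_\xi^{u_k}(t,x)=\mathcal S[\Phi_\xi^{u_k}(W)\,|\,(t,x)].$$ Then the series defining $\mathcal M_\xi^{u_k}(t,x)$ converges absolutely for all $t\ge0$, $x\in\mathbb Z$, and: 1. (M1) For all $j,k$ and every starting point $x\in\mathbb Z^N$, the process $\mathcal M_\xi^{u_k}(t,V_j(t))$, $t\ge0$, is a martingale under $\mathrm P_x$, both in the natural filtration of $V_j$ and in that of $V$. 2. (M2) For every $t\ge0$ the functions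 $x\mapsto\mathcal M_\xi^{u_k}(t,x)$ on $\mathbb Z$, $1\le k\le N$, are linearly independent. 3. (M3) For all $j,k$ one has $\lim_{t\downarrow0}\mathrm E_u[\mathcal M_\xi^{u_k}(t,V_j(t))]=\delta_{jk}$; in fact the expectation equals $\delta_{jk}$ for every $t\ge0$. 4. (Determinantal martingale representation) For all $0\le t\le T<\infty$ and every bounded $\mathcal F(t)$-measurable function $F$ of the configuration path, both expectations below are of integrable random variables and $$\mathbb E_\xi[F(\Xi(\cdot))]=\mathrm E_u\Big[F\Big(\sum_{j=1}^N\delta_{V_j(\cdot)}\Big)\det_{1\le j,k\le N}\big[\mathcal M_\xi^{u_k}(T,V_j(T))\big]\Big].$$ -/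

import Mathlib

open MeasureTheory ProbabilityTheory Filter Topology
open scoped NNReal ENNReal

namespace NoncollidingRW

/-! ### Paths, Weyl chamber, exit time -/

/-- Right-continuity with existence of left limits. -/
def IsCadlagPath {E : Type*} [TopologicalSpace E] (f : ℝ≥0 → E) : Prop :=
  ∀ t, ContinuousWithinAt f (Set.Ici t) t ∧ ∃ l, Tendsto f (𝓝[<] t) (𝓝 l)

/-- Lattice points of the Weyl chamber of type `A`: `x 0 < x 1 < ⋯`. -/
def Chamber (N : ℕ) : Set (Fin N → ℤ) := {x | StrictMono x}

/-- The exit time `inf {t ≥ 0 : V t ∉ Chamber}`, equal to `∞` if there is no such `t`. -/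
noncomputable def exitTime {N : ℕ} {Ω : Type*} (V : ℝ≥0 → Ω → Fin N → ℤ) (ω : Ω) : ℝ≥0∞ :=
  sInf ((fun t : ℝ≥0 => (t : ℝ≥0∞)) '' {t : ℝ≥0 | V t ω ∉ Chamber N})

/-! ### Continuous-time simple symmetric random walk -/

/-- `V` is a continuous-time simple symmetric random walk on `ℤ` started at `x`: a Lévy process
(shifted by `x`) with characteristic function `exp (t (cos z - 1))`. -/
structure IsRandomWalk {Ω : Type*} [MeasurableSpace Ω] (P : Measure Ω)
    (V : ℝ≥0 → Ω → ℤ) (x : ℤ) : Prop where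
  measurable : ∀ t, Measurable (V t)
  start : ∀ᵐ ω ∂P, V 0 ω = x
  cadlag : ∀ᵐ ω ∂P, IsCadlagPath (fun t => V t ω)
  indep_increments : HasIndepIncrements V P
  char_increment : ∀ s t : ℝ≥0, s ≤ t → ∀ z : ℂ,
    ∫ ω, Complex.exp (Complex.I * z * ((V t ω - V s ω : ℤ) : ℂ)) ∂P
      = Complex.exp ((((t : ℝ) - (s : ℝ) : ℝ) : ℂ) * (Complex.cos z - 1))

/-- Under `P x` the coordinates of `V` are independent random walks, the `j`-th one started
at `x j`; this is required for every starting point `x`. -/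
structure IsRandomWalkFamily {N : ℕ} {Ω : Type*} [MeasurableSpace Ω]
    (P : (Fin N → ℤ) → Measure Ω) (V : ℝ≥0 → Ω → Fin N → ℤ) : Prop where
  prob : ∀ x, IsProbabilityMeasure (P x)
  measurable : ∀ t, Measurable (V t)
  coord : ∀ x j, IsRandomWalk (P x) (fun t ω => V t ω j) (x j)
  indep : ∀ x, iIndepFun (fun (j : Fin N) (ω : Ω) (t : ℝ≥0) => V t ω j) (P x)

/-! ### The `h`-transform of the walk killed on leaving the chamber -/

/-- The Vandermonde determinant `det [x_j ^ (k-1)]`. -/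
noncomputable def h {N : ℕ} (x : Fin N → ℤ) : ℝ :=
  (Matrix.vandermonde (fun j => (x j : ℝ))).det

/-- `P_x (V t = y, τ > t)`, the transition probability of the walk absorbed on leaving
the chamber. -/
noncomputable def absorbedTransition {N : ℕ} {Ω : Type*} [MeasurableSpace Ω]
    (P : (Fin N → ℤ) → Measure Ω) (V : ℝ≥0 → Ω → Fin N → ℤ)
    (t : ℝ≥0) (x y : Fin N → ℤ) : ℝ :=
  (P x).real {ω | V t ω = y ∧ (t : ℝ≥0∞) < exitTime V ω}

/-- Doob's `h`-transform of the absorbed transition probability. -/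
noncomputable def doobTransition {N : ℕ} {Ω : Type*} [MeasurableSpace Ω]
    (P : (Fin N → ℤ) → Measure Ω) (V : ℝ≥0 → Ω → Fin N → ℤ)
    (t : ℝ≥0) (x y : Fin N → ℤ) : ℝ :=
  absorbedTransition P V t x y * (h y / h x)

/-- `X` is, under `Q`, the (labeled) noncolliding random walk started at `u`: the càdlàg Markov
process in the chamber whose transition probabilities are the `h`-transform of those of the
absorbed walk. -/
structure IsNoncollidingWalk {N : ℕ} {Ω Ω' : Type*} [MeasurableSpace Ω] [MeasurableSpace Ω']
    (P : (Fin N → ℤ) → Measure Ω) (V : ℝ≥0 → Ω → Fin N → ℤ) (u : Fin N → ℤ)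
    (Q : Measure Ω') (X : ℝ≥0 → Ω' → Fin N → ℤ) : Prop where
  prob : IsProbabilityMeasure Q
  measurable : ∀ t, Measurable (X t)
  start : ∀ᵐ ω ∂Q, X 0 ω = u
  mem_chamber : ∀ᵐ ω ∂Q, ∀ t, X t ω ∈ Chamber N
  cadlag : ∀ᵐ ω ∂Q, IsCadlagPath (fun t => X t ω)
  finite_dim : ∀ (n : ℕ) (t : Fin (n + 1) → ℝ≥0) (x : Fin (n + 1) → Fin N → ℤ),
    Monotone t → t 0 = 0 → x 0 = u → (∀ i, x i ∈ Chamber N) →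
    Q.real {ω | ∀ i, X (t i) ω = x i}
      = ∏ i : Fin n, doobTransition P V (t i.succ - t i.castSucc) (x i.castSucc) (x i.succ)

/-! ### Unlabeled configurations -/

/-- Nonnegative integer-valued Radon measures on `ℤ`. On the discrete space `ℤ` it is enough
to ask that each singleton has a finite integer mass. -/
def Config : Type := {ξ : Measure ℤ // ∀ x : ℤ, ∃ n : ℕ, ξ {x} = n}

/-- The σ-algebra generated by the evaluations `ξ ↦ ξ A`. -/
instance : MeasurableSpace Config :=
  inferInstanceAs (MeasurableSpace {ξ : Measure ℤ // ∀ x : ℤ, ∃ n : ℕ, ξ {x} = n})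

/-- The configuration `∑ j, δ_{x j}`. -/
noncomputable def config {N : ℕ} (x : Fin N → ℤ) : Config :=
  ⟨∑ j, Measure.dirac (x j), fun a => by
    classical
    refine ⟨∑ j, if x j = a then 1 else 0, ?_⟩
    simp [Measure.finsetSum_apply, Set.indicator_apply]⟩

/-- The σ-algebra `𝓕(t) = σ (Ξ(s) : 0 ≤ s ≤ t)` on configuration paths. -/
abbrev configSigma (t : ℝ≥0) : MeasurableSpace (ℝ≥0 → Config) :=
  ⨆ s : ℝ≥0, ⨆ _ : s ≤ t,
    MeasurableSpace.comap (fun η : ℝ≥0 → Config => η s) inferInstance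

/-! ### The transformation `S` and the functions `M_ξ^{u_k}` -/

/-- Modified Bessel function of the first kind of nonnegative integer order `n`. -/
noncomputable def besselI (n : ℕ) (z : ℝ) : ℝ :=
  (z / 2) ^ n * ∑' l : ℕ, (z / 2) ^ (2 * l) / ((l.factorial : ℝ) * Real.Gamma (n + l + 1))

/-- `S[f(W) | (t, x)] = e^t ∑_{w ∈ ℤ} I_{|w-x|}(-t) f(w)`. -/
noncomputable def S (f : ℤ → ℂ) (t : ℝ≥0) (x : ℤ) : ℂ :=
  (Real.exp t : ℂ) * ∑' w : ℤ, (besselI (w - x).natAbs (-(t : ℝ)) : ℂ) * f w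

/-- The Lagrange polynomial `Φ_ξ^{u_k}(z) = ∏_{j ≠ k} (z - u_j) / (u_k - u_j)`. -/
noncomputable def Phi {N : ℕ} (u : Fin N → ℤ) (k : Fin N) (z : ℂ) : ℂ :=
  ∏ j ∈ Finset.univ.erase k, (z - (u j : ℂ)) / ((u k : ℂ) - (u j : ℂ))

/-- `M_ξ^{u_k}(t, x) = S[Φ_ξ^{u_k}(W) | (t, x)]`. -/
noncomputable def M {N : ℕ} (u : Fin N → ℤ) (k : Fin N) (t : ℝ≥0) (x : ℤ) : ℂ :=
  S (fun w => Phi u k (w : ℂ)) t x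

/-- The natural filtration `σ (V s : 0 ≤ s ≤ t)`. -/
def natFiltration {N : ℕ} {Ω : Type*} [MeasurableSpace Ω] (V : ℝ≥0 → Ω → Fin N → ℤ)
    (hV : ∀ t, Measurable (V t)) : Filtration ℝ≥0 (inferInstance : MeasurableSpace Ω) :=
  Filtration.natural V (fun t => (hV t).stronglyMeasurable)

/-- The natural filtration `σ (V_j s : 0 ≤ s ≤ t)` of a single coordinate. -/
def natFiltrationCoord {N : ℕ} {Ω : Type*} [MeasurableSpace Ω] (V : ℝ≥0 → Ω → Fin N → ℤ)
    (hV : ∀ t, Measurable (V t)) (j : Fin N) :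
    Filtration ℝ≥0 (inferInstance : MeasurableSpace Ω) :=
  Filtration.natural (fun t ω => V t ω j)
    (fun t => ((measurable_pi_apply j).comp (hV t)).stronglyMeasurable)

/-- Conditions (M1), (M2), (M3) on a family of functions `m k (t, x)`. -/
structure SatisfiesM {N : ℕ} {Ω : Type*} [MeasurableSpace Ω]
    (P : (Fin N → ℤ) → Measure Ω) (V : ℝ≥0 → Ω → Fin N → ℤ) (hV : ∀ t, Measurable (V t))
    (u : Fin N → ℤ) (m : Fin N → ℝ≥0 → ℤ → ℂ) : Prop where
  /-- (M1), for each walk in its own filtration, from every starting point. -/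
  m1 : ∀ x j k, Martingale (fun t ω => m k t (V t ω j)) (natFiltrationCoord V hV j) (P x)
  /-- (M1), in the joint filtration of the `N` walks, from every starting point. -/
  m1_joint : ∀ x j k, Martingale (fun t ω => m k t (V t ω j)) (natFiltration V hV) (P x)
  /-- (M2): linear independence over `ℂ` at every time. -/
  m2 : ∀ t, LinearIndependent ℂ (fun k => m k t)
  /-- (M3). -/
  m3 : ∀ j k, Tendsto (fun t : ℝ≥0 => ∫ ω, m k t (V t ω j) ∂(P u)) (𝓝[>] 0)
    (𝓝 (if j = k then 1 else 0))
  /-- (M3), in the form valid at every time. -/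
  m3_all : ∀ j k (t : ℝ≥0), ∫ ω, m k t (V t ω j) ∂(P u) = if j = k then 1 else 0

end NoncollidingRW

/-!
The proof has an algebraic half, about the functions `M u k`, and a probabilistic half, about
the noncolliding walk.

The transformation `S` at time `t` inverts the semigroup of the walk. The generating function of
the Bessel functions shows that `f ↦ ∑_w I_{|w - x|}(t) f(w)` is the operator
`exp ((t/2) (E + E⁻¹))`, with `E` the unit shift, on functions of exponential growth, and these
operators form a one-parameter group in `t ∈ ℝ` (`besselSum_add`). For `t ≥ 0` the law of an
increment of the walk is `e^{-t} I_{|n|}(t)`, because both have the same characteristic function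
(`IsRandomWalk.measure_increment`). Hence averaging `S f t` over an increment of length `t - s`
gives `S f s`, which is the martingale property (M1); evaluation at time zero gives (M3).
Moreover `S` maps the monomial of degree `m` to a monic polynomial of degree `m`
(`momentPoly`), so the determinant of the `M u k` at time `T` is the ratio `h (V T) / h u`
of Vandermonde determinants (`det_M`), and (M2) follows by evaluating at the points `u j`.

It remains to show that `h (V T) / h u` is a (signed) density, on events that depend only on the
unlabeled configuration up to time `T`, of the noncolliding walk with respect to the free walk. The
free walk is not killed here: contributions of paths with a collision cancel by antisymmetry of `h`.
The Karlin–McGregor formula `IsRandomWalkFamily.absorbedTransition_eq` expresses the absorbed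
transition probabilities as determinants `kmDet`. It is obtained without a strong Markov
property. The determinant `kmDet` is antisymmetric and satisfies the Chapman–Kolmogorov equation
with the free transition probabilities; a walk killed only when a grid of mesh `s` sees it
outside the chamber differs from it by `O(s ^ 2)` per step, since `kmDet` vanishes on the walls and
a step over a wall needs two unit jumps (`IsRandomWalkFamily.grid_error`). The mesh is sent
to zero along dyadic grids, which determine the exit time by right-continuity.
Given this formula, an induction over finitely many observation times
(`antisymm_cylinder`) compares the antisymmetrized law of the free walk with the law of the
noncolliding walk on cylinder events, and a π-system argument extends the identity to all
bounded `𝓕(T)`-measurable functionals (`integral_configPath_eq`).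
-/

namespace NoncollidingRW

/-! ### Exponential series of shifts -/

/-- Functions on `ℤ` of at most exponential growth. This class contains the polynomials and the
characters, and all Bessel sums of its members converge absolutely. -/
def ExpBdd (f : ℤ → ℂ) : Prop :=
  ∃ C ρ : ℝ, 0 ≤ C ∧ 1 ≤ ρ ∧ ∀ n, ‖f n‖ ≤ C * ρ ^ n.natAbs

lemma ExpBdd.const (c : ℂ) : ExpBdd fun _ => c :=
  ⟨‖c‖, 1, norm_nonneg _, le_rfl, fun n => by simp⟩

lemma ExpBdd.intCast : ExpBdd fun n => (n : ℂ) := by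
  refine ⟨1, 2, zero_le_one, one_le_two, fun n => ?_⟩
  rw [Complex.norm_intCast, one_mul, ← Int.cast_abs, Int.abs_eq_natAbs]
  exact_mod_cast n.natAbs.lt_two_pow_self.le

lemma ExpBdd.mul {f g : ℤ → ℂ} (hf : ExpBdd f) (hg : ExpBdd g) : ExpBdd fun n => f n * g n := by
  obtain ⟨C, ρ, hC, hρ, hf⟩ := hf
  obtain ⟨D, σ, hD, hσ, hg⟩ := hg
  refine ⟨C * D, ρ * σ, by positivity, one_le_mul_of_one_le_of_one_le hρ hσ, fun n => ?_⟩
  rw [norm_mul, mul_pow, mul_mul_mul_comm]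
  exact mul_le_mul (hf n) (hg n) (norm_nonneg _) (by positivity)

lemma ExpBdd.add {f g : ℤ → ℂ} (hf : ExpBdd f) (hg : ExpBdd g) : ExpBdd fun n => f n + g n := by
  obtain ⟨C, ρ, hC, hρ, hf⟩ := hf
  obtain ⟨D, σ, hD, hσ, hg⟩ := hg
  refine ⟨C + D, ρ * σ, by positivity, one_le_mul_of_one_le_of_one_le hρ hσ, fun n => ?_⟩
  have h1 : ρ ^ n.natAbs ≤ (ρ * σ) ^ n.natAbs := by gcongr; nlinarith
  have h2 : σ ^ n.natAbs ≤ (ρ * σ) ^ n.natAbs := by gcongr; nlinarith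
  calc ‖f n + g n‖ ≤ ‖f n‖ + ‖g n‖ := norm_add_le _ _
    _ ≤ C * ρ ^ n.natAbs + D * σ ^ n.natAbs := add_le_add (hf n) (hg n)
    _ ≤ C * (ρ * σ) ^ n.natAbs + D * (ρ * σ) ^ n.natAbs := by gcongr
    _ = _ := by ring

lemma ExpBdd.prod {ι : Type*} (s : Finset ι) {f : ι → ℤ → ℂ} (hf : ∀ i ∈ s, ExpBdd (f i)) :
    ExpBdd fun n => ∏ i ∈ s, f i n := by
  classical
  induction s using Finset.induction_on with
  | empty => simpa using ExpBdd.const 1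
  | insert a s ha ih =>
    simp only [Finset.prod_insert ha]
    exact (hf a (by simp)).mul (ih fun i hi => hf i (by simp [hi]))

lemma ExpBdd.pow {f : ℤ → ℂ} (hf : ExpBdd f) (m : ℕ) : ExpBdd fun n => f n ^ m := by
  simpa using ExpBdd.prod (Finset.range m) (f := fun _ => f) fun _ _ => hf

lemma ExpBdd.cexp (z : ℂ) : ExpBdd fun n => Complex.exp (z * n) := by
  refine ⟨1, Real.exp ‖z‖, zero_le_one, Real.one_le_exp (norm_nonneg _), fun n => ?_⟩
  rw [one_mul, ← Real.exp_nat_mul, Complex.norm_exp]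
  refine Real.exp_le_exp.2 ((Complex.re_le_norm _).trans ?_)
  rw [norm_mul, Complex.norm_intCast, ← Int.cast_abs, Int.abs_eq_natAbs, mul_comm]
  simp

/-- `exp (t E)` applied to `f`, where `E` is the shift by `ε`. -/
noncomputable def shiftExp (ε : ℤ) (t : ℂ) (f : ℤ → ℂ) (x : ℤ) : ℂ :=
  ∑' a : ℕ, t ^ a / (a.factorial : ℂ) * f (x + ε * a)

lemma norm_coeff (t : ℂ) (a : ℕ) :
    ‖t ^ a / (a.factorial : ℂ)‖ = ‖t‖ ^ a / (a.factorial : ℝ) := by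
  simp

lemma summable_exp_mul (t ρ : ℝ) : Summable fun a : ℕ => t ^ a / (a.factorial : ℝ) * ρ ^ a := by
  refine (Real.summable_pow_div_factorial (t * ρ)).congr fun a => ?_
  rw [mul_pow]; ring

lemma ExpBdd.natAbs_bound {f : ℤ → ℂ} {C ρ : ℝ} (hC : 0 ≤ C) (hρ : 1 ≤ ρ)
    (hf : ∀ n, ‖f n‖ ≤ C * ρ ^ n.natAbs) {m k : ℕ} {n : ℤ} (h : n.natAbs ≤ m + k) :
    ‖f n‖ ≤ C * ρ ^ m * ρ ^ k := by
  refine (hf n).trans ?_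
  rw [mul_assoc, ← pow_add]
  exact mul_le_mul_of_nonneg_left (pow_le_pow_right₀ hρ h) hC

lemma ExpBdd.shiftExp {ε : ℤ} (hε : ε.natAbs = 1) (t : ℂ) {f : ℤ → ℂ} (hf : ExpBdd f) :
    ExpBdd (shiftExp ε t f) := by
  obtain ⟨C, ρ, hC, hρ, hf⟩ := hf
  refine ⟨C * ∑' a : ℕ, (‖t‖ ^ a / (a.factorial : ℝ) * ρ ^ a), ρ,
    mul_nonneg hC (tsum_nonneg fun a => by positivity), hρ, fun x => ?_⟩
  have := tsum_of_norm_bounded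
    (f := fun a : ℕ => t ^ a / (a.factorial : ℂ) * f (x + ε * a))
    (((summable_exp_mul ‖t‖ ρ).mul_left (C * ρ ^ x.natAbs)).hasSum) fun a => by
      rw [norm_mul, norm_coeff]
      have := ExpBdd.natAbs_bound hC hρ hf (m := x.natAbs) (k := a) (n := x + ε * a)
        ((Int.natAbs_add_le _ _).trans (by rw [Int.natAbs_mul, hε]; simp))
      calc _ ≤ ‖t‖ ^ a / (a.factorial : ℝ) * (C * ρ ^ x.natAbs * ρ ^ a) := by gcongr
        _ = _ := by ring
  refine this.trans_eq ?_
  rw [tsum_mul_left]; ring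

lemma summable_shiftExp_prod {ε δ : ℤ} (hε : ε.natAbs = 1) (hδ : δ.natAbs = 1) (s t : ℂ)
    {f : ℤ → ℂ} (hf : ExpBdd f) (x : ℤ) :
    Summable fun p : ℕ × ℕ => s ^ p.1 / (p.1.factorial : ℂ) * (t ^ p.2 / (p.2.factorial : ℂ)) *
      f (x + ε * p.1 + δ * p.2) := by
  obtain ⟨C, ρ, hC, hρ, hf⟩ := hf
  have h0 := (summable_exp_mul ‖s‖ ρ).mul_of_nonneg (summable_exp_mul ‖t‖ ρ)
    (fun a => by positivity) (fun a => by positivity)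
  refine Summable.of_norm_bounded (h0.mul_left (C * ρ ^ x.natAbs)) fun p => ?_
  rw [norm_mul, norm_mul, norm_coeff, norm_coeff]
  have := ExpBdd.natAbs_bound hC hρ hf (m := x.natAbs) (k := p.1 + p.2)
    (n := x + ε * p.1 + δ * p.2) (by
      refine (Int.natAbs_add_le _ _).trans
        ((Nat.add_le_add_right (Int.natAbs_add_le _ _) _).trans ?_)
      rw [Int.natAbs_mul, hε, Int.natAbs_mul, hδ]; simp [add_assoc])
  calc _ ≤ ‖s‖ ^ p.1 / (p.1.factorial : ℝ) * (‖t‖ ^ p.2 / (p.2.factorial : ℝ)) *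
        (C * ρ ^ x.natAbs * ρ ^ (p.1 + p.2)) := by gcongr
    _ = _ := by rw [pow_add]; ring

lemma shiftExp_shiftExp {ε δ : ℤ} (hε : ε.natAbs = 1) (hδ : δ.natAbs = 1) (s t : ℂ)
    {f : ℤ → ℂ} (hf : ExpBdd f) (x : ℤ) :
    shiftExp ε s (shiftExp δ t f) x = ∑' p : ℕ × ℕ, s ^ p.1 / (p.1.factorial : ℂ) *
      (t ^ p.2 / (p.2.factorial : ℂ)) * f (x + ε * p.1 + δ * p.2) := by
  rw [(summable_shiftExp_prod hε hδ s t hf x).tsum_prod]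
  simp only [shiftExp, ← tsum_mul_left, mul_assoc]

/-- Exponentials of shifts commute; both sides are the same absolutely convergent double series. -/
lemma shiftExp_comm {ε δ : ℤ} (hε : ε.natAbs = 1) (hδ : δ.natAbs = 1) (s t : ℂ)
    {f : ℤ → ℂ} (hf : ExpBdd f) :
    shiftExp ε s (shiftExp δ t f) = shiftExp δ t (shiftExp ε s f) := by
  funext x
  rw [shiftExp_shiftExp hε hδ s t hf, shiftExp_shiftExp hδ hε t s hf,
    ← (Equiv.prodComm ℕ ℕ).tsum_eq]
  refine tsum_congr fun p => ?_
  simp only [Equiv.prodComm_apply, Prod.fst_swap, Prod.snd_swap]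
  rw [mul_comm (s ^ _ / _)]
  congr 2
  ring

/-- `exp (s E) exp (t E) = exp ((s + t) E)`, by the binomial theorem along antidiagonals. -/
lemma shiftExp_add {ε : ℤ} (hε : ε.natAbs = 1) (s t : ℂ) {f : ℤ → ℂ} (hf : ExpBdd f) :
    shiftExp ε s (shiftExp ε t f) = shiftExp ε (s + t) f := by
  funext x
  have hs := summable_shiftExp_prod hε hε s t hf x
  have hs' := Finset.HasAntidiagonal.sigmaAntidiagonalEquivProd.summable_iff.2 hs
  simp only [Function.comp_def] at hs'
  rw [shiftExp_shiftExp hε hε s t hf, ← Finset.HasAntidiagonal.sigmaAntidiagonalEquivProd.tsum_eq,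
    Summable.tsum_sigma' (fun _ => (hasSum_fintype _).summable) hs']
  refine tsum_congr fun n => ?_
  rw [tsum_fintype, Finset.univ_eq_attach]
  simp only [Finset.HasAntidiagonal.sigmaAntidiagonalEquivProd_apply]
  rw [Finset.sum_attach (Finset.HasAntidiagonal.antidiagonal n)
      (fun p : ℕ × ℕ => s ^ p.1 / (p.1.factorial : ℂ) * (t ^ p.2 / (p.2.factorial : ℂ)) *
        f (x + ε * p.1 + ε * p.2)),
    (Commute.all s t).add_pow', Finset.sum_div, Finset.sum_mul]
  refine Finset.sum_congr rfl fun p hp => ?_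
  rw [Finset.HasAntidiagonal.mem_antidiagonal] at hp
  subst hp
  have h1 : ((p.1 + p.2).choose p.1 : ℂ) * p.1.factorial * p.2.factorial
      = (p.1 + p.2).factorial := by
    rw [Nat.choose_symm_add]
    exact_mod_cast Nat.add_choose_mul_factorial_mul_factorial p.1 p.2
  have h2 : (p.1.factorial : ℂ) ≠ 0 := by exact_mod_cast p.1.factorial_ne_zero
  have h3 : (p.2.factorial : ℂ) ≠ 0 := by exact_mod_cast p.2.factorial_ne_zero
  have h4 : ((p.1 + p.2).factorial : ℂ) ≠ 0 := by exact_mod_cast (p.1 + p.2).factorial_ne_zero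
  have h5 : x + ε * p.1 + ε * p.2 = x + ε * ((p.1 + p.2 : ℕ) : ℤ) := by push_cast; ring
  rw [h5, nsmul_eq_mul]
  congr 1
  field_simp
  rw [← h1]
  ring

/-! ### Bessel sums -/

/-- `ℤ × ℕ ≃ ℕ × ℕ`, sending `(n, l)` to the pair with difference `n` and minimum `l`. -/
def diffMinEquiv : ℤ × ℕ ≃ ℕ × ℕ where
  toFun p := (p.1.toNat + p.2, (-p.1).toNat + p.2)
  invFun q := ((q.1 : ℤ) - q.2, min q.1 q.2)
  left_inv p := by ext <;> grind
  right_inv q := by ext <;> grind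

/-- The Bessel coefficient at `n` collects the terms of `exp ((t/2) E) exp ((t/2) E⁻¹)` that shift
by `n` in total. -/
lemma besselI_eq_tsum (n : ℤ) (t : ℝ) :
    besselI n.natAbs t = ∑' l : ℕ, (t / 2) ^ (diffMinEquiv (n, l)).1 /
      ((diffMinEquiv (n, l)).1.factorial : ℝ) *
      ((t / 2) ^ (diffMinEquiv (n, l)).2 / ((diffMinEquiv (n, l)).2.factorial : ℝ)) := by
  rw [besselI, ← tsum_mul_left]
  refine tsum_congr fun l => ?_
  have hG : Real.Gamma ((n.natAbs : ℝ) + l + 1) = ((n.natAbs + l).factorial : ℝ) := by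
    rw [← Real.Gamma_nat_eq_factorial]; push_cast; rfl
  rw [hG]
  simp only [diffMinEquiv, Equiv.coe_fn_mk]
  rcases le_total 0 n with h | h
  · have h1 : n.toNat = n.natAbs := by omega
    have h2 : (-n).toNat = 0 := by omega
    rw [h1, h2, zero_add, div_mul_div_comm, ← pow_add, ← mul_div_assoc, ← pow_add, mul_comm (_ : ℝ)
      ((n.natAbs + l).factorial : ℝ)]
    congr 2; ring
  · have h1 : (-n).toNat = n.natAbs := by omega
    have h2 : n.toNat = 0 := by omega
    rw [h1, h2, zero_add, div_mul_div_comm, ← pow_add, ← mul_div_assoc, ← pow_add]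
    congr 2; ring

/-- `∑_w I_{|w-x|}(t) f(w)`; this is `exp ((t/2) (E + E⁻¹)) f` at `x`, with `E` the unit shift. -/
noncomputable def besselSum (t : ℝ) (f : ℤ → ℂ) (x : ℤ) : ℂ :=
  ∑' w : ℤ, (besselI (w - x).natAbs t : ℂ) * f w

lemma hasSum_besselSum (t : ℝ) {f : ℤ → ℂ} (hf : ExpBdd f) (x : ℤ) :
    HasSum (fun w : ℤ => (besselI (w - x).natAbs t : ℂ) * f w)
      (shiftExp 1 (t / 2 : ℝ) (shiftExp (-1) (t / 2 : ℝ) f) x) := by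
  rw [shiftExp_shiftExp (by rfl) (by rfl) _ _ hf]
  have hs := summable_shiftExp_prod (ε := 1) (δ := -1) (by rfl) (by rfl)
    (t / 2 : ℝ) (t / 2 : ℝ) hf x
  have h1 := (diffMinEquiv.hasSum_iff.2 hs.hasSum).prod_fiberwise fun n =>
    ((diffMinEquiv.summable_iff.2 hs).prod_factor n).hasSum
  rw [← (Equiv.subRight x).hasSum_iff] at h1
  convert! h1 using 2 with w
  simp only [Function.comp_apply, Equiv.subRight_apply]
  rw [besselI_eq_tsum, Complex.ofReal_tsum, ← tsum_mul_right]
  refine tsum_congr fun l => ?_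
  have h2 : x + 1 * ((diffMinEquiv (w - x, l)).1 : ℤ) + -1 * ((diffMinEquiv (w - x, l)).2 : ℤ)
      = w := by
    have := congrArg Prod.fst (diffMinEquiv.symm_apply_apply (w - x, l))
    change ((diffMinEquiv (w - x, l)).1 : ℤ) - ((diffMinEquiv (w - x, l)).2 : ℤ) = w - x at this
    omega
  rw [h2]
  push_cast
  rfl

lemma besselSum_eq (t : ℝ) {f : ℤ → ℂ} (hf : ExpBdd f) (x : ℤ) :
    besselSum t f x = shiftExp 1 (t / 2 : ℝ) (shiftExp (-1) (t / 2 : ℝ) f) x :=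
  (hasSum_besselSum t hf x).tsum_eq

lemma ExpBdd.besselSum (t : ℝ) {f : ℤ → ℂ} (hf : ExpBdd f) : ExpBdd (besselSum t f) := by
  have : NoncollidingRW.besselSum t f = fun x => _ := funext fun x => besselSum_eq t hf x
  rw [this]
  exact (hf.shiftExp (by rfl) _).shiftExp (by rfl) _

/-- The operators `besselSum t`, `t ∈ ℝ`, form a one-parameter group. -/
lemma besselSum_add (s t : ℝ) {f : ℤ → ℂ} (hf : ExpBdd f) :
    besselSum s (besselSum t f) = besselSum (s + t) f := by
  have key : ∀ t (g : ℤ → ℂ), ExpBdd g → besselSum t g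
      = shiftExp 1 (t / 2 : ℝ) (shiftExp (-1) (t / 2 : ℝ) g) :=
    fun t g hg => funext fun x => besselSum_eq t hg x
  have p1 : (1 : ℤ).natAbs = 1 := rfl
  have m1 : (-1 : ℤ).natAbs = 1 := rfl
  rw [key s _ (hf.besselSum t), key t f hf, key (s + t) f hf,
    shiftExp_comm m1 p1 _ _ (hf.shiftExp m1 _), shiftExp_add p1 _ _
      ((hf.shiftExp m1 _).shiftExp m1 _), shiftExp_add m1 _ _ hf]
  push_cast
  rw [add_div]

lemma shiftExp_cexp (ε : ℤ) (t z : ℂ) (x : ℤ) :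
    shiftExp ε t (fun n => Complex.exp (z * n)) x
      = Complex.exp (t * Complex.exp (z * ε)) * Complex.exp (z * x) := by
  have : ∀ a : ℕ, t ^ a / (a.factorial : ℂ) * Complex.exp (z * ((x + ε * a : ℤ) : ℂ))
      = (t * Complex.exp (z * ε)) ^ a / (a.factorial : ℂ) * Complex.exp (z * x) := fun a => by
    push_cast
    rw [mul_add, Complex.exp_add, mul_pow, ← Complex.exp_nat_mul]
    rw [show z * ((ε : ℂ) * a) = a * (z * ε) by ring]
    ring
  simp only [shiftExp, this]
  rw [tsum_mul_right, Complex.exp_eq_exp_ℂ, NormedSpace.exp_eq_tsum_div]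

lemma besselSum_cexp (t : ℝ) (z : ℂ) (x : ℤ) :
    besselSum t (fun n => Complex.exp (Complex.I * z * n)) x
      = Complex.exp (t * Complex.cos z) * Complex.exp (Complex.I * z * x) := by
  rw [besselSum_eq t (ExpBdd.cexp _)]
  have : shiftExp (-1) (t / 2 : ℝ) (fun n => Complex.exp (Complex.I * z * n))
      = fun n : ℤ => Complex.exp ((t / 2 : ℝ) * Complex.exp (Complex.I * z * (-1 : ℤ))) *
        Complex.exp (Complex.I * z * n) := funext fun x => shiftExp_cexp _ _ _ _
  rw [this]
  have h2 : ∀ (c : ℂ) (ε : ℤ) (t : ℂ) (g : ℤ → ℂ) (x : ℤ),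
      shiftExp ε t (fun n => c * g n) x = c * shiftExp ε t g x := fun c ε t g x => by
    simp only [shiftExp, ← tsum_mul_left]
    exact tsum_congr fun a => by ring
  rw [h2, shiftExp_cexp, ← mul_assoc, ← Complex.exp_add, Complex.cos]
  congr 2
  push_cast
  rw [mul_comm Complex.I z]
  ring_nf

/-! ### Martingale polynomials and the determinant -/

section

lemma S_eq (f : ℤ → ℂ) (t : ℝ≥0) (x : ℤ) :
    S f t x = Complex.exp t * besselSum (-t) f x := by
  rw [S, besselSum]; norm_cast

lemma besselSum_one (t : ℝ) (x : ℤ) : besselSum t (fun _ => 1) x = Complex.exp t := by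
  simpa using besselSum_cexp t 0 x

lemma besselSum_zero {f : ℤ → ℂ} (hf : ExpBdd f) : besselSum 0 f = f := by
  have h : ∀ (ε : ℤ) (f : ℤ → ℂ), shiftExp ε 0 f = f := fun ε f => funext fun x => by
    rw [shiftExp, tsum_eq_single 0 fun a ha => by simp [ha]]
    simp
  funext x
  rw [besselSum_eq 0 hf]
  simp [h]

lemma S_zero {f : ℤ → ℂ} (hf : ExpBdd f) (x : ℤ) : S f 0 x = f x := by
  simp [S_eq, besselSum_zero hf]

lemma besselSum_eq_shift (t : ℝ) (f : ℤ → ℂ) (x : ℤ) :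
    besselSum t f x = besselSum t (fun n => f (x + n)) 0 := by
  rw [besselSum, ← (Equiv.addLeft x).tsum_eq]
  simp [besselSum]

lemma besselSum_finset_sum {ι : Type*} (s : Finset ι) (c : ι → ℂ) (f : ι → ℤ → ℂ)
    (hf : ∀ i ∈ s, ExpBdd (f i)) (t : ℝ) (x : ℤ) :
    besselSum t (fun n => ∑ i ∈ s, c i * f i n) x = ∑ i ∈ s, c i * besselSum t (f i) x := by
  simp only [besselSum]
  simp only [← tsum_mul_left]
  rw [← Summable.tsum_finsetSum]
  · refine tsum_congr fun n => ?_
    rw [Finset.mul_sum]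
    exact Finset.sum_congr rfl fun i _ => by ring
  · exact fun i hi => (hasSum_besselSum t (hf i hi) x).summable.mul_left _

lemma S_finset_sum {ι : Type*} (s : Finset ι) (c : ι → ℂ) (f : ι → ℤ → ℂ)
    (hf : ∀ i ∈ s, ExpBdd (f i)) (t : ℝ≥0) (x : ℤ) :
    S (fun n => ∑ i ∈ s, c i * f i n) t x = ∑ i ∈ s, c i * S (f i) t x := by
  simp only [S_eq, besselSum_finset_sum s c f hf, Finset.mul_sum]
  exact Finset.sum_congr rfl fun i _ => by ring

open Polynomial in
/-- The polynomial in `x` given by `S[W ^ m | (t, x)]`. -/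
noncomputable def momentPoly (t : ℝ≥0) (m : ℕ) : ℂ[X] :=
  X ^ m + ∑ i : Fin m, C ((m.choose i : ℂ) * S (fun n => (n : ℂ) ^ (m - i)) t 0) * X ^ (i : ℕ)

open Polynomial in
lemma momentPoly_degree_lt (t : ℝ≥0) (m : ℕ) :
    (∑ i : Fin m, C ((m.choose i : ℂ) * S (fun n => (n : ℂ) ^ (m - i)) t 0) *
      X ^ (i : ℕ)).degree < (m : WithBot ℕ) :=
  degree_sum_fin_lt _

lemma momentPoly_monic (t : ℝ≥0) (m : ℕ) : (momentPoly t m).Monic :=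
  Polynomial.monic_X_pow_add (momentPoly_degree_lt t m)

lemma momentPoly_natDegree (t : ℝ≥0) (m : ℕ) : (momentPoly t m).natDegree = m := by
  rw [momentPoly, Polynomial.natDegree_add_eq_left_of_degree_lt, Polynomial.natDegree_X_pow]
  rw [Polynomial.degree_X_pow]
  exact momentPoly_degree_lt t m

lemma S_pow (t : ℝ≥0) (m : ℕ) (x : ℤ) :
    S (fun n => (n : ℂ) ^ m) t x = (momentPoly t m).eval (x : ℂ) := by
  have h1 : S (fun n => (n : ℂ) ^ m) t x = S (fun n => ∑ i ∈ Finset.range (m + 1),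
      ((x : ℂ) ^ i * m.choose i) * (n : ℂ) ^ (m - i)) t 0 := by
    rw [S_eq, S_eq, besselSum_eq_shift]
    congr 2
    funext n
    push_cast
    rw [add_pow]
    exact Finset.sum_congr rfl fun i _ => by ring
  rw [h1, S_finset_sum _ _ _ fun i _ => ExpBdd.intCast.pow _, Finset.sum_range_succ, momentPoly]
  have h2 : S (fun n => (n : ℂ) ^ (m - m)) t 0 = 1 := by
    simp only [Nat.sub_self, pow_zero, S_eq, besselSum_one]
    rw [← Complex.exp_add]; simp
  rw [h2, Finset.sum_range]
  simp only [Polynomial.eval_add, Polynomial.eval_pow, Polynomial.eval_X, Polynomial.eval_finsetSum,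
    Polynomial.eval_mul, Polynomial.eval_C, Nat.choose_self, Nat.cast_one, mul_one]
  rw [add_comm]
  congr 1
  exact Finset.sum_congr rfl fun i _ => by ring

variable {N : ℕ}

lemma ExpBdd.Phi (u : Fin N → ℤ) (k : Fin N) : ExpBdd fun w => Phi u k (w : ℂ) := by
  refine ExpBdd.prod _ fun j _ => ?_
  simp only [div_eq_mul_inv, sub_eq_add_neg]
  exact (ExpBdd.intCast.add (ExpBdd.const _)).mul (ExpBdd.const _)

/-- Coefficients of the Lagrange polynomials: column `k` holds those of `Phi u k`. -/
noncomputable def lagrangeCoeff (u : Fin N → ℤ) : Matrix (Fin N) (Fin N) ℂ :=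
  Matrix.of fun i k => (Lagrange.basis Finset.univ (fun j => (u j : ℂ)) k).coeff i

lemma castInj {u : Fin N → ℤ} (hu : u ∈ Chamber N) : Function.Injective fun j => (u j : ℂ) :=
  Int.cast_injective.comp (StrictMono.injective hu)

lemma Phi_eq_sum {u : Fin N → ℤ} (hu : u ∈ Chamber N) (k : Fin N) (z : ℂ) :
    Phi u k z = ∑ i : Fin N, lagrangeCoeff u i k * z ^ (i : ℕ) := by
  have h1 : Phi u k z = (Lagrange.basis Finset.univ (fun j => (u j : ℂ)) k).eval z := by
    rw [Phi, Lagrange.basis, Polynomial.eval_prod]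
    refine Finset.prod_congr rfl fun j _ => ?_
    simp [Lagrange.basisDivisor, div_eq_inv_mul]
  have hN : 0 < N := k.pos
  have hd : (Lagrange.basis Finset.univ (fun j => (u j : ℂ)) k).natDegree < N := by
    refine (Polynomial.natDegree_lt_iff_degree_lt
      (Lagrange.basis_ne_zero (castInj hu).injOn (Finset.mem_univ k))).2 ?_
    rw [Lagrange.degree_basis (castInj hu).injOn (Finset.mem_univ k)]
    simp only [Finset.card_univ, Fintype.card_fin]
    exact_mod_cast Nat.sub_lt hN one_pos
  rw [h1, Polynomial.eval_eq_sum_range' hd, Finset.sum_range]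
  rfl

lemma M_eq_sum {u : Fin N → ℤ} (hu : u ∈ Chamber N) (k : Fin N) (t : ℝ≥0) (x : ℤ) :
    M u k t x = ∑ i : Fin N, (momentPoly t i).eval (x : ℂ) * lagrangeCoeff u i k := by
  rw [M]
  simp only [Phi_eq_sum hu k]
  rw [S_finset_sum _ _ _ fun i _ => ExpBdd.intCast.pow _]
  exact Finset.sum_congr rfl fun i _ => by rw [S_pow, mul_comm]

/-- The Lagrange interpolation property at the nodes. -/
lemma Phi_apply {u : Fin N → ℤ} (hu : u ∈ Chamber N) (j k : Fin N) :
    Phi u k (u j) = if j = k then 1 else 0 := by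
  split_ifs with h
  · subst h
    refine Finset.prod_eq_one fun i hi => div_self (sub_ne_zero.2 fun h => ?_)
    exact (Finset.ne_of_mem_erase hi) (castInj hu h).symm
  · exact Finset.prod_eq_zero (Finset.mem_erase.2 ⟨h, Finset.mem_univ j⟩) (by simp)

lemma ofReal_h (x : Fin N → ℤ) :
    (h x : ℂ) = (Matrix.vandermonde fun j => (x j : ℂ)).det := by
  rw [h, Matrix.det_vandermonde, Matrix.det_vandermonde]
  push_cast
  rfl

/-- The matrix of coefficients of the Lagrange polynomials inverts the Vandermonde matrix. -/
lemma h_mul_det_lagrangeCoeff {u : Fin N → ℤ} (hu : u ∈ Chamber N) :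
    (h u : ℂ) * (lagrangeCoeff u).det = 1 := by
  rw [ofReal_h, ← Matrix.det_mul]
  convert Matrix.det_one (n := Fin N) (R := ℂ)
  ext j k
  rw [Matrix.mul_apply, Matrix.one_apply, ← Phi_apply hu, Phi_eq_sum hu]
  exact Finset.sum_congr rfl fun i _ => by rw [Matrix.vandermonde_apply, mul_comm]

lemma h_pos {x : Fin N → ℤ} (hx : x ∈ Chamber N) : 0 < h x := by
  rw [h, Matrix.det_vandermonde]
  refine Finset.prod_pos fun i _ => Finset.prod_pos fun j hj => sub_pos.2 ?_
  exact_mod_cast hx (Finset.mem_Ioi.1 hj)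

/-- Replacing monomials by the monic polynomials `momentPoly t m` does not change a Vandermonde
determinant, so the martingale determinant does not depend on time. -/
lemma det_M {u : Fin N → ℤ} (hu : u ∈ Chamber N) (t : ℝ≥0) (x : Fin N → ℤ) :
    (Matrix.of fun j k : Fin N => M u k t (x j)).det = ((h x / h u : ℝ) : ℂ) := by
  have h1 : (Matrix.of fun j k : Fin N => M u k t (x j))
      = (Matrix.of fun j i : Fin N => (momentPoly t i).eval (x j : ℂ)) * lagrangeCoeff u := by
    ext j k
    rw [Matrix.mul_apply, Matrix.of_apply, M_eq_sum hu]
    rfl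
  have h2 := Matrix.det_eval_matrixOfPolynomials_eq_det_vandermonde (fun j => (x j : ℂ))
    (fun i : Fin N => momentPoly t i) (fun i => momentPoly_natDegree t i)
    (fun i => momentPoly_monic t i)
  have h0 : (h u : ℂ) ≠ 0 := by exact_mod_cast (h_pos hu).ne'
  rw [h1, Matrix.det_mul, ← h2, ← ofReal_h, Complex.ofReal_div, eq_div_iff h0, mul_assoc,
    mul_comm (lagrangeCoeff u).det, h_mul_det_lagrangeCoeff hu, mul_one]

lemma linearIndependent_M {u : Fin N → ℤ} (hu : u ∈ Chamber N) (t : ℝ≥0) :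
    LinearIndependent ℂ fun k => M u k t := by
  have h1 : (Matrix.of fun j k : Fin N => M u k t (u j)).det ≠ 0 := by
    rw [det_M hu, div_self (h_pos hu).ne']; simp
  have h2 := Matrix.linearIndependent_cols_of_det_ne_zero h1
  exact LinearIndependent.of_comp (LinearMap.funLeft ℂ ℂ u) h2

lemma M_zero (u : Fin N → ℤ) (k : Fin N) (x : ℤ) : M u k 0 x = Phi u k x :=
  S_zero (ExpBdd.Phi u k) x

lemma ExpBdd.M (u : Fin N → ℤ) (k : Fin N) (t : ℝ≥0) : ExpBdd (M u k t) := by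
  have : NoncollidingRW.M u k t = fun x => Complex.exp t *
    NoncollidingRW.besselSum (-t) (fun w => NoncollidingRW.Phi u k (w : ℂ)) x :=
      funext fun x => S_eq _ _ _
  rw [this]
  exact (ExpBdd.const _).mul ((ExpBdd.Phi u k).besselSum _)

lemma summable_M (u : Fin N → ℤ) (k : Fin N) (t : ℝ≥0) (x : ℤ) :
    Summable fun w : ℤ => (besselI (w - x).natAbs (-(t : ℝ)) : ℂ) * Phi u k (w : ℂ) :=
  (hasSum_besselSum _ (ExpBdd.Phi u k) x).summable

/-- Averaging `S f t` over a walk run for time `t - s` gives `S f s`. -/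
lemma besselSum_S {f : ℤ → ℂ} (hf : ExpBdd f) (s t : ℝ≥0) (x : ℤ) :
    Complex.exp (-((t : ℝ) - s : ℝ)) * besselSum ((t : ℝ) - s) (S f t) x = S f s x := by
  have h1 : S f t = fun x => Complex.exp t * besselSum (-t) f x := funext fun x => S_eq f t x
  have h2 := besselSum_finset_sum {()} (fun _ => Complex.exp t) (fun _ => besselSum (-t) f)
    (fun _ _ => hf.besselSum _) ((t : ℝ) - s) x
  simp only [Finset.sum_singleton] at h2
  rw [h1, h2, besselSum_add _ _ hf, S_eq, ← mul_assoc, ← Complex.exp_add]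
  push_cast
  ring_nf

end

/-! ### Markov chains in continuous time on a countable space -/

/-- `Y` has the finite-dimensional distributions of the time-homogeneous Markov chain started at
`a` with transition weights `K`. -/
structure IsMarkovChain {E Ω : Type*} [MeasurableSpace E] [MeasurableSpace Ω] (μ : Measure Ω)
    (Y : ℝ≥0 → Ω → E) (a : E) (K : ℝ≥0 → E → E → ℝ≥0∞) : Prop where
  prob : IsProbabilityMeasure μ
  measurable : ∀ t, Measurable (Y t)
  start : ∀ᵐ ω ∂μ, Y 0 ω = a
  fdd : ∀ (n : ℕ) (t : Fin (n + 1) → ℝ≥0) (x : Fin (n + 1) → E), Monotone t → t 0 = 0 → x 0 = a →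
    μ {ω | ∀ i, Y (t i) ω = x i} =
      ∏ i : Fin n, K (t i.succ - t i.castSucc) (x i.castSucc) (x i.succ)

/-- Finitely many times up to `s` are contained in an increasing sequence from `0` to `s`. -/
lemma exists_enumeration (s : ℝ≥0) (I : Finset ℝ≥0) (hI : ∀ r ∈ I, r ≤ s) :
    ∃ (n : ℕ) (τ : Fin (n + 1) → ℝ≥0), Monotone τ ∧ τ 0 = 0 ∧ τ (Fin.last n) = s ∧
      ∀ r ∈ I, ∃ i, τ i = r := by
  classical
  let J : Finset ℝ≥0 := insert 0 (insert s I)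
  have hJ : 0 < J.card := Finset.card_pos.2 ⟨0, by simp [J]⟩
  have hc : J.card = (J.card - 1) + 1 := by omega
  let τ := J.orderEmbOfFin hc
  have hr : ∀ r ∈ J, ∃ i, τ i = r := fun r hr => by
    have : r ∈ Set.range τ := by rw [Finset.range_orderEmbOfFin]; exact hr
    exact this
  have hle : ∀ i, τ i ≤ s := fun i => by
    have := J.orderEmbOfFin_mem hc i
    simp only [J, Finset.mem_insert] at this
    rcases this with h | h | h
    · simp [τ, J, h]
    · exact h.le
    · exact hI _ h
  refine ⟨J.card - 1, τ, τ.monotone, ?_, ?_, fun r h => hr r (by simp [J, h])⟩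
  · obtain ⟨i, hi⟩ := hr 0 (by simp [J])
    exact le_antisymm (hi ▸ τ.monotone (Fin.zero_le i)) zero_le
  · obtain ⟨i, hi⟩ := hr s (by simp [J])
    exact le_antisymm (hle _) (hi ▸ τ.monotone (Fin.le_last i))

namespace IsMarkovChain

variable {E Ω : Type*} [MeasurableSpace E] {Y : ℝ≥0 → Ω → E}

/-- The σ-algebra generated by `Y r` for `r ≤ s`. -/
abbrev past (Y : ℝ≥0 → Ω → E) (s : ℝ≥0) : MeasurableSpace Ω :=
  ⨆ r : ℝ≥0, ⨆ _ : r ≤ s, MeasurableSpace.comap (Y r) inferInstance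

lemma measurableSet_past [Countable E] [MeasurableSingletonClass E] {r s : ℝ≥0} (hr : r ≤ s)
    (B : Set E) : MeasurableSet[past Y s] (Y r ⁻¹' B) :=
  (le_iSup₂ (f := fun (r : ℝ≥0) (_ : r ≤ s) => MeasurableSpace.comap (Y r) inferInstance) r hr) _
    ⟨B, B.to_countable.measurableSet, rfl⟩

variable [MeasurableSpace Ω] {μ : Measure Ω} {a : E} {K : ℝ≥0 → E → E → ℝ≥0∞}

lemma past_le (hY : ∀ t, Measurable (Y t)) (s : ℝ≥0) :
    past Y s ≤ (inferInstance : MeasurableSpace Ω) :=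
  iSup₂_le fun r _ => (hY r).comap_le

/-- The Markov property for a past that fixes the positions at finitely many times. -/
lemma fdd_snoc (hY : IsMarkovChain μ Y a K) {n : ℕ} {τ : Fin (n + 1) → ℝ≥0} (hτ : Monotone τ)
    (h0 : τ 0 = 0) {t : ℝ≥0} (ht : τ (Fin.last n) ≤ t) (z y : E) (x : Fin (n + 1) → E) :
    μ ({ω | ∀ i, Y (τ i) ω = x i} ∩ ({ω | Y (τ (Fin.last n)) ω = z} ∩ {ω | Y t ω = y}))
      = K (t - τ (Fin.last n)) z y *
        μ ({ω | ∀ i, Y (τ i) ω = x i} ∩ {ω | Y (τ (Fin.last n)) ω = z}) := by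
  by_cases hx0 : x 0 = a
  swap
  · have h1 : μ {ω | ∀ i, Y (τ i) ω = x i} = 0 := by
      refine measure_mono_null (fun ω hω => ?_) hY.start
      simp only [Set.mem_compl_iff, Set.mem_ofPred_eq]
      rw [← h0, hω 0]; exact hx0
    rw [measure_mono_null Set.inter_subset_left h1, measure_mono_null Set.inter_subset_left h1,
      mul_zero]
  by_cases hz : x (Fin.last n) = z
  swap
  · have h2 : {ω | ∀ i, Y (τ i) ω = x i} ∩ {ω | Y (τ (Fin.last n)) ω = z} = ∅ := by
      ext ω
      simp only [Set.mem_inter_iff, Set.mem_ofPred_eq, Set.mem_empty_iff_false, iff_false, not_and]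
      exact fun h h' => hz ((h _).symm.trans h')
    rw [← Set.inter_assoc, h2]; simp
  have e1 : {ω | ∀ i, Y (τ i) ω = x i} ∩ {ω | Y (τ (Fin.last n)) ω = z}
      = {ω | ∀ i, Y (τ i) ω = x i} :=
    Set.inter_eq_left.2 fun ω hω => (hω _).trans hz
  have e2 : {ω | ∀ i, Y (τ i) ω = x i} ∩ {ω | Y t ω = y}
      = {ω | ∀ i, Y (Fin.snoc (α := fun _ => ℝ≥0) τ t i) ω = Fin.snoc (α := fun _ => E) x y i} := by
    ext ω
    simp only [Set.mem_inter_iff, Set.mem_ofPred_eq, Fin.forall_fin_succ' (n := n + 1),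
      Fin.snoc_castSucc, Fin.snoc_last]
  rw [← Set.inter_assoc, e1, e2, hY.fdd n τ x hτ h0 hx0, hY.fdd (n + 1), Fin.prod_univ_castSucc]
  · simp only [Fin.succ_castSucc, Fin.snoc_castSucc, Fin.succ_last, Fin.snoc_last, hz]
    rw [mul_comm]
  · intro i j hij
    induction j using Fin.lastCases with
    | last =>
      induction i using Fin.lastCases with
      | last => exact le_rfl
      | cast i =>
        simp only [Fin.snoc_castSucc, Fin.snoc_last]
        exact (hτ (Fin.le_last i)).trans ht
    | cast j =>
      induction i using Fin.lastCases with
      | last => exact absurd hij (not_le.2 (Fin.castSucc_lt_last j))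
      | cast i =>
        simp only [Fin.snoc_castSucc]
        exact hτ (Fin.castSucc_le_castSucc_iff.1 hij)
  · rw [← Fin.castSucc_zero, Fin.snoc_castSucc, h0]
  · rw [← Fin.castSucc_zero, Fin.snoc_castSucc, hx0]

lemma apply_eq (hY : IsMarkovChain μ Y a K) (t : ℝ≥0) (y : E) : μ {ω | Y t ω = y} = K t a y := by
  have := hY.fdd 1 ![0, t] ![a, y] (by
    intro i j hij
    fin_cases i <;> fin_cases j <;> simp_all) rfl rfl
  simp only [Nat.reduceAdd, Fin.forall_fin_two, Matrix.cons_val_zero, Matrix.cons_val_one,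
    Finset.univ_unique, Fin.default_eq_zero, Finset.prod_singleton, Fin.succ_zero_eq_one,
    Matrix.cons_val_one, Matrix.cons_val_zero, Fin.castSucc_zero, tsub_zero] at this
  rw [← this]
  refine measure_congr ?_
  filter_upwards [hY.start] with ω hω
  exact propext ⟨fun h => ⟨hω, h⟩, fun h => h.2⟩

variable [Countable E] [MeasurableSingletonClass E]

lemma markov_cylinder (hY : IsMarkovChain μ Y a K) {n : ℕ} {τ : Fin (n + 1) → ℝ≥0}
    (hτ : Monotone τ) (h0 : τ 0 = 0) {t : ℝ≥0} (ht : τ (Fin.last n) ≤ t) (z y : E)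
    (B : Set (Fin (n + 1) → E)) :
    μ ({ω | (fun i => Y (τ i) ω) ∈ B} ∩ ({ω | Y (τ (Fin.last n)) ω = z} ∩ {ω | Y t ω = y}))
      = K (t - τ (Fin.last n)) z y *
        μ ({ω | (fun i => Y (τ i) ω) ∈ B} ∩ {ω | Y (τ (Fin.last n)) ω = z}) := by
  have hm : Measurable fun ω i => Y (τ i) ω := measurable_pi_lambda _ fun i => hY.measurable _
  have hsm : ∀ C : Set (Fin (n + 1) → E), MeasurableSet C := fun C => C.to_countable.measurableSet
  have key : (μ.restrict ({ω | Y (τ (Fin.last n)) ω = z} ∩ {ω | Y t ω = y})).map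
      (fun ω i => Y (τ i) ω) = K (t - τ (Fin.last n)) z y •
        (μ.restrict {ω | Y (τ (Fin.last n)) ω = z}).map (fun ω i => Y (τ i) ω) := by
    refine Measure.ext_of_singleton fun x => ?_
    rw [Measure.smul_apply, Measure.map_apply hm (hsm _), Measure.map_apply hm (hsm _),
      Measure.restrict_apply (hm (hsm _)), Measure.restrict_apply (hm (hsm _)), smul_eq_mul]
    have e : (fun ω i => Y (τ i) ω) ⁻¹' {x} = {ω | ∀ i, Y (τ i) ω = x i} := by
      ext ω; simp [funext_iff]
    rw [e]
    exact hY.fdd_snoc hτ h0 ht z y x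
  have := congrArg (fun ν : Measure (Fin (n + 1) → E) => ν B) key
  simp only [Measure.smul_apply, Measure.map_apply hm (hsm _),
    Measure.restrict_apply (hm (hsm _)), smul_eq_mul] at this
  exact this

/-- The Markov property with respect to the full past. -/
lemma markov (hY : IsMarkovChain μ Y a K) {s t : ℝ≥0} (hst : s ≤ t) (z y : E) {A : Set Ω}
    (hA : MeasurableSet[past Y s] A) :
    μ (A ∩ ({ω | Y s ω = z} ∩ {ω | Y t ω = y}))
      = K (t - s) z y * μ (A ∩ {ω | Y s ω = z}) := by
  have := hY.prob
  have hms : ∀ (t : ℝ≥0) (y : E), MeasurableSet {ω | Y t ω = y} := fun t y =>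
    hY.measurable t (measurableSet_singleton y)
  have hpi : ∀ A, MeasurableSet A → μ.restrict ({ω | Y s ω = z} ∩ {ω | Y t ω = y}) A
      = μ (A ∩ ({ω | Y s ω = z} ∩ {ω | Y t ω = y})) := fun A hA => Measure.restrict_apply hA
  have hpi' : ∀ A, MeasurableSet A → (K (t - s) z y • μ.restrict {ω | Y s ω = z}) A
      = K (t - s) z y * μ (A ∩ {ω | Y s ω = z}) := fun A hA => by
    rw [Measure.smul_apply, Measure.restrict_apply hA, smul_eq_mul]
  have hcyl : ∀ I : Finset ℝ≥0, (∀ r ∈ I, r ≤ s) → ∀ B : ℝ≥0 → Set E,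
      μ ((⋂ r ∈ I, Y r ⁻¹' B r) ∩ ({ω | Y s ω = z} ∩ {ω | Y t ω = y}))
        = K (t - s) z y * μ ((⋂ r ∈ I, Y r ⁻¹' B r) ∩ {ω | Y s ω = z}) := by
    intro I hI B
    obtain ⟨n, τ, hτ, h0, hl, hr⟩ := exists_enumeration s I hI
    have e : (⋂ r ∈ I, Y r ⁻¹' B r)
        = {ω | (fun i => Y (τ i) ω) ∈ {x | ∀ i, τ i ∈ I → x i ∈ B (τ i)}} := by
      ext ω
      simp only [Set.mem_iInter, Set.mem_preimage, Set.mem_ofPred_eq]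
      refine ⟨fun h i hi => h _ hi, fun h r hrI => ?_⟩
      obtain ⟨i, rfl⟩ := hr r hrI
      exact h i hrI
    rw [e, ← hl]
    exact hY.markov_cylinder hτ h0 (hl.trans_le hst) z y _
  rw [← hpi A (past_le hY.measurable s A hA), ← hpi' A (past_le hY.measurable s A hA)]
  refine ext_on_measurableSpace_of_generate_finite _
    (piiUnionInter (fun r => {A | MeasurableSet[MeasurableSpace.comap (Y r) inferInstance] A})
      {r | r ≤ s}) ?_ (past_le hY.measurable s)
    (generateFrom_piiUnionInter_measurableSet _ _).symm
    (isPiSystem_piiUnionInter _ (fun r => @MeasurableSpace.isPiSystem_measurableSet _ (_)) _) ?_ hA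
  · rintro _ ⟨I, hI, f, hf, rfl⟩
    have hf' : ∀ r, ∃ B : Set E, r ∈ I → f r = Y r ⁻¹' B := fun r => by
      by_cases hr : r ∈ I
      · obtain ⟨B, -, hB⟩ := hf r hr
        exact ⟨B, fun _ => hB.symm⟩
      · exact ⟨∅, fun h => absurd h hr⟩
    choose B hB using hf'
    have e : (⋂ r ∈ I, f r) = ⋂ r ∈ I, Y r ⁻¹' B r :=
      Set.iInter₂_congr hB
    have hm : MeasurableSet (⋂ r ∈ I, Y r ⁻¹' B r) :=
      I.measurableSet_biInter fun r _ => hY.measurable r (B r).to_countable.measurableSet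
    rw [e, hpi _ hm, hpi' _ hm]
    exact hcyl I (fun r hr => hI hr) B
  · have := hcyl ∅ (by simp) fun _ => ∅
    rw [hpi _ .univ, hpi' _ .univ]
    simpa using this

lemma measure_eq_tsum (hY : IsMarkovChain μ Y a K) (s : ℝ≥0) {A : Set Ω} (hA : MeasurableSet A) :
    μ A = ∑' z, μ (A ∩ {ω | Y s ω = z}) := by
  have hms : ∀ z : E, MeasurableSet {ω | Y s ω = z} := fun y =>
    hY.measurable s (measurableSet_singleton y)
  rw [← measure_iUnion _ fun z => hA.inter (hms z)]
  · congr 1; ext ω; simp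
  · intro z z' hzz'
    refine Set.disjoint_left.2 fun ω h h' => hzz' (h.2.symm.trans h'.2)

/-- Total probability over the position at time `s`. -/
lemma markov_tsum (hY : IsMarkovChain μ Y a K) {s t : ℝ≥0} (hst : s ≤ t) (y : E) {A : Set Ω}
    (hA : MeasurableSet[past Y s] A) :
    μ (A ∩ {ω | Y t ω = y}) = ∑' z, μ (A ∩ {ω | Y s ω = z}) * K (t - s) z y := by
  have hm : MeasurableSet {ω | Y t ω = y} := hY.measurable t (measurableSet_singleton y)
  rw [hY.measure_eq_tsum s ((past_le hY.measurable s A hA).inter hm)]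
  refine tsum_congr fun z => ?_
  rw [Set.inter_assoc, Set.inter_comm {ω | Y t ω = y}, hY.markov hst z y hA, mul_comm]

lemma hasSum_markov (hY : IsMarkovChain μ Y a K) {s t : ℝ≥0} (hst : s ≤ t) (y : E) {A : Set Ω}
    (hA : MeasurableSet[past Y s] A) :
    HasSum (fun z => μ.real (A ∩ {ω | Y s ω = z}) * (K (t - s) z y).toReal)
      (μ.real (A ∩ {ω | Y t ω = y})) := by
  have := hY.prob
  have h1 := hY.markov_tsum hst y hA
  simp only [measureReal_def, ← ENNReal.toReal_mul]
  have h2 : ∑' z, μ (A ∩ {ω | Y s ω = z}) * K (t - s) z y ≠ ∞ := h1 ▸ measure_ne_top _ _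
  rw [h1, ENNReal.tsum_toReal_eq fun z => ENNReal.ne_top_of_tsum_ne_top h2 z]
  exact ENNReal.hasSum_toReal h2

end IsMarkovChain

/-! ### The law of the simple symmetric walk -/

/-- `P_0 (V t = n)` for the simple symmetric walk. -/
noncomputable def stepProb (t : ℝ≥0) (n : ℤ) : ℝ := Real.exp (-t) * besselI n.natAbs t

lemma stepProb_nonneg (t : ℝ≥0) (n : ℤ) : 0 ≤ stepProb t n := by
  rw [stepProb, besselI_eq_tsum]
  exact mul_nonneg (Real.exp_pos _).le (tsum_nonneg fun l => by positivity)

/-- The law at time `t` of the simple symmetric walk started at `x`. -/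
noncomputable def stepLaw (t : ℝ≥0) (x : ℤ) : Measure ℤ :=
  Measure.sum fun n : ℤ => ENNReal.ofReal (stepProb t (n - x)) • Measure.dirac n

lemma stepLaw_singleton (t : ℝ≥0) (x n : ℤ) :
    stepLaw t x {n} = ENNReal.ofReal (stepProb t (n - x)) := by
  rw [stepLaw, Measure.sum_apply _ (measurableSet_singleton n), tsum_eq_single n]
  · simp
  · intro m hm
    simp [Set.indicator, hm]

lemma hasSum_stepProb (t : ℝ≥0) {f : ℤ → ℂ} (hf : ExpBdd f) (x : ℤ) :
    HasSum (fun n : ℤ => (stepProb t (n - x) : ℂ) * f n)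
      (Complex.exp (-t) * besselSum t f x) := by
  have h1 := (hasSum_besselSum t hf x).mul_left (Complex.exp (-t))
  rw [← besselSum_eq t hf] at h1
  convert! h1 using 2 with n
  rw [stepProb]
  push_cast
  ring

lemma integrable_stepLaw (t : ℝ≥0) {f : ℤ → ℂ} (hf : ExpBdd f) (x : ℤ) :
    Integrable f (stepLaw t x) := by
  refine integrable_sum_dirac (fun n => ENNReal.ofReal_ne_top) ?_
  refine (hasSum_stepProb t hf x).summable.norm.congr fun n => ?_
  rw [norm_mul, Complex.norm_real, Real.norm_of_nonneg (stepProb_nonneg _ _),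
    ENNReal.toReal_ofReal (stepProb_nonneg _ _)]

lemma integral_stepLaw (t : ℝ≥0) {f : ℤ → ℂ} (hf : ExpBdd f) (x : ℤ) :
    ∫ n, f n ∂stepLaw t x = Complex.exp (-t) * besselSum t f x := by
  rw [← (hasSum_stepProb t hf x).tsum_eq, stepLaw,
    integral_sum_dirac fun n => ENNReal.ofReal_ne_top]
  refine tsum_congr fun n => ?_
  rw [ENNReal.toReal_ofReal (stepProb_nonneg _ _), Complex.real_smul]

lemma hasSum_stepProb_one (t : ℝ≥0) (x : ℤ) : HasSum (fun n : ℤ => stepProb t (n - x)) 1 := by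
  have := hasSum_stepProb t (ExpBdd.const 1) x
  rw [besselSum_one, ← Complex.exp_add, neg_add_cancel, Complex.exp_zero] at this
  simp only [mul_one] at this
  rw [← Complex.ofReal_one] at this
  exact Complex.hasSum_ofReal.1 this

instance (t : ℝ≥0) (x : ℤ) : IsProbabilityMeasure (stepLaw t x) := by
  refine ⟨?_⟩
  rw [stepLaw, Measure.sum_apply _ .univ]
  simp only [Measure.smul_apply, Measure.dirac_apply_of_mem (Set.mem_univ _), smul_eq_mul, mul_one]
  rw [← ENNReal.ofReal_tsum_of_nonneg (fun n => stepProb_nonneg _ _)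
    (hasSum_stepProb_one t x).summable, (hasSum_stepProb_one t x).tsum_eq, ENNReal.ofReal_one]

/-- The law `stepLaw t 0`, pushed forward to `ℝ`, has the characteristic function of the walk. -/
lemma charFun_map_stepLaw (t : ℝ≥0) (z : ℝ) :
    charFun ((stepLaw t 0).map fun n : ℤ => (n : ℝ)) z = Complex.exp (t * (Complex.cos z - 1)) := by
  have h1 := integral_stepLaw t (ExpBdd.cexp (Complex.I * z)) 0
  rw [besselSum_cexp] at h1
  rw [charFun_apply_real, integral_map (by fun_prop) (by fun_prop)]
  have h2 : ∀ n : ℤ, Complex.exp (z * ((n : ℝ) : ℂ) * Complex.I)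
      = Complex.exp (Complex.I * z * n) := fun n => by congr 1; push_cast; ring
  refine (integral_congr_ae (ae_of_all _ h2)).trans ?_
  rw [h1, Int.cast_zero, mul_zero, Complex.exp_zero, mul_one, ← Complex.exp_add]
  congr 1
  ring

section Walk
variable {Ω : Type*} [MeasurableSpace Ω]

/-- The law of an increment is determined by its characteristic function. -/
lemma IsRandomWalk.measure_increment {P : Measure Ω} [IsProbabilityMeasure P] {V : ℝ≥0 → Ω → ℤ}
    {x : ℤ} (hV : IsRandomWalk P V x) {s t : ℝ≥0} (hst : s ≤ t) (n : ℤ) :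
    P {ω | V t ω - V s ω = n} = ENNReal.ofReal (stepProb (t - s) n) := by
  have hm : Measurable fun ω => V t ω - V s ω := (hV.measurable t).sub (hV.measurable s)
  have hmc : Measurable fun n : ℤ => (n : ℝ) := by fun_prop
  have : IsProbabilityMeasure (P.map fun ω => V t ω - V s ω) :=
    Measure.isProbabilityMeasure_map hm.aemeasurable
  have key : (P.map fun ω => V t ω - V s ω).map (fun n : ℤ => (n : ℝ))
      = (stepLaw (t - s) 0).map fun n : ℤ => (n : ℝ) := by
    refine Measure.ext_of_charFun (funext fun z => ?_)
    rw [charFun_map_stepLaw, charFun_apply_real, Measure.map_map hmc hm,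
      integral_map (hmc.comp hm).aemeasurable (by fun_prop)]
    have h1 := hV.char_increment s t hst z
    rw [NNReal.coe_sub hst]
    push_cast at h1 ⊢
    rw [← h1]
    refine integral_congr_ae (ae_of_all _ fun ω => ?_)
    change Complex.exp (z * (((V t ω - V s ω : ℤ) : ℝ) : ℂ) * Complex.I) = _
    congr 1
    push_cast; ring
  have h2 := congrArg (fun ν : Measure ℝ => ν {(n : ℝ)}) key
  have e : (fun n : ℤ => (n : ℝ)) ⁻¹' {(n : ℝ)} = {n} := by
    ext m; simp
  simp only [Measure.map_apply hmc (measurableSet_singleton _), e, stepLaw_singleton, sub_zero,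
    Measure.map_apply hm (measurableSet_singleton _)] at h2
  exact h2

lemma IsRandomWalk.isMarkovChain {P : Measure Ω} [IsProbabilityMeasure P] {V : ℝ≥0 → Ω → ℤ}
    {x : ℤ} (hV : IsRandomWalk P V x) :
    IsMarkovChain P V x fun t x y => ENNReal.ofReal (stepProb t (y - x)) := by
  refine ⟨inferInstance, hV.measurable, hV.start, fun n t y ht h0 hy => ?_⟩
  have h1 := (hV.indep_increments n t ht).measure_inter_preimage_eq_mul Finset.univ
    (sets := fun i => {y i.succ - y i.castSucc}) fun _ _ => measurableSet_singleton _
  have h2 : ∀ i : Fin n, P ((fun ω => V (t i.succ) ω - V (t i.castSucc) ω) ⁻¹'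
      {y i.succ - y i.castSucc}) = ENNReal.ofReal (stepProb (t i.succ - t i.castSucc)
        (y i.succ - y i.castSucc)) := fun i =>
    hV.measure_increment (ht i.castSucc_lt_succ.le) _
  rw [Finset.prod_congr rfl fun i _ => h2 i] at h1
  rw [← h1]
  refine measure_congr ?_
  filter_upwards [hV.start] with ω hω
  refine propext ⟨fun h => ?_, fun h => ?_⟩
  · refine Set.mem_iInter₂.2 fun i _ => ?_
    change V (t i.succ) ω - V (t i.castSucc) ω = y i.succ - y i.castSucc
    rw [h, h]
  · have h : ∀ i : Fin n, V (t i.succ) ω - V (t i.castSucc) ω = y i.succ - y i.castSucc :=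
      fun i => Set.mem_iInter₂.1 h i (Finset.mem_univ i)
    intro i
    induction i using Fin.induction with
    | zero => rw [h0, hω, hy]
    | succ i ih => have := h i; rw [ih] at this; linarith

variable {N : ℕ}

/-- `P_x (V t = y)` for `N` independent walks. -/
noncomputable def freeProb (t : ℝ≥0) (x y : Fin N → ℤ) : ℝ := ∏ j, stepProb t (y j - x j)

lemma freeProb_nonneg (t : ℝ≥0) (x y : Fin N → ℤ) : 0 ≤ freeProb t x y :=
  Finset.prod_nonneg fun _ _ => stepProb_nonneg _ _

lemma pi_stepLaw_singleton (t : ℝ≥0) (x y : Fin N → ℤ) :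
    Measure.pi (fun j => stepLaw t (x j)) {y} = ENNReal.ofReal (freeProb t x y) := by
  rw [Measure.pi_singleton, freeProb, ENNReal.ofReal_prod_of_nonneg fun _ _ => stepProb_nonneg _ _]
  simp only [stepLaw_singleton]

variable {P : (Fin N → ℤ) → Measure Ω} {V : ℝ≥0 → Ω → Fin N → ℤ}

lemma IsRandomWalkFamily.isMarkovChain (hV : IsRandomWalkFamily P V) (x : Fin N → ℤ) :
    IsMarkovChain (P x) V x fun t x y => ENNReal.ofReal (freeProb t x y) := by
  have := hV.prob x
  refine ⟨inferInstance, hV.measurable, ?_, fun n t y ht h0 hy => ?_⟩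
  · filter_upwards [ae_all_iff.2 fun j => (hV.coord x j).start] with ω hω
    exact funext hω
  have h1 := (hV.indep x).measure_inter_preimage_eq_mul Finset.univ
    (sets := fun j => {f | ∀ i, f (t i) = y i j}) fun j _ => by
      have : {f : ℝ≥0 → ℤ | ∀ i, f (t i) = y i j} = ⋂ i, (fun f => f (t i)) ⁻¹' {y i j} := by
        ext f; simp
      rw [this]
      exact MeasurableSet.iInter fun i => measurable_pi_apply _ (measurableSet_singleton _)
  have h2 : ∀ j, P x ((fun ω t => V t ω j) ⁻¹' {f | ∀ i, f (t i) = y i j})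
      = ∏ i : Fin n, ENNReal.ofReal (stepProb (t i.succ - t i.castSucc)
        (y i.succ j - y i.castSucc j)) := fun j =>
    (hV.coord x j).isMarkovChain.fdd n t (fun i => y i j) ht h0 (by rw [hy])
  simp only [h2] at h1
  rw [Finset.prod_comm] at h1
  have e : {ω | ∀ i, V (t i) ω = y i} = ⋂ j ∈ (Finset.univ : Finset (Fin N)),
      (fun ω t => V t ω j) ⁻¹' {f | ∀ i, f (t i) = y i j} := by
    ext ω
    simp only [Set.mem_ofPred_eq, Finset.mem_univ, Set.iInter_true, Set.mem_iInter,
      Set.mem_preimage, funext_iff]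
    exact forall_comm
  rw [e, h1]
  refine Finset.prod_congr rfl fun i _ => ?_
  rw [freeProb, ENNReal.ofReal_prod_of_nonneg fun _ _ => stepProb_nonneg _ _]

/-! ### The martingale property -/

lemma IsRandomWalkFamily.map_eq (hV : IsRandomWalkFamily P V) (x : Fin N → ℤ) (t : ℝ≥0) :
    (P x).map (V t) = Measure.pi fun j => stepLaw t (x j) := by
  refine Measure.ext_of_singleton fun y => ?_
  rw [Measure.map_apply (hV.measurable t) (measurableSet_singleton y), pi_stepLaw_singleton,
    ← (hV.isMarkovChain x).apply_eq]
  rfl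

lemma IsRandomWalkFamily.integrable_coord (hV : IsRandomWalkFamily P V) (x : Fin N → ℤ) (t : ℝ≥0)
    (j : Fin N) {f : ℤ → ℂ} (hf : ExpBdd f) : Integrable (fun ω => f (V t ω j)) (P x) := by
  have h1 : Integrable (fun y : Fin N → ℤ => f (y j)) ((P x).map (V t)) := by
    rw [hV.map_eq]
    exact (measurePreserving_eval (fun j => stepLaw t (x j)) j).integrable_comp_of_integrable
      (integrable_stepLaw t hf (x j))
  exact h1.comp_measurable (hV.measurable t)

lemma IsRandomWalkFamily.setIntegral_coord (hV : IsRandomWalkFamily P V) (x : Fin N → ℤ)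
    {s t : ℝ≥0} (hst : s ≤ t) (j : Fin N) (f : ℤ → ℂ) (z : Fin N → ℤ) {A : Set Ω}
    (hA : MeasurableSet[IsMarkovChain.past V s] A) :
    ∫ ω in A ∩ {ω | V s ω = z}, f (V t ω j) ∂P x
      = ∫ ω in A ∩ {ω | V s ω = z}, ∫ n, f n ∂stepLaw (t - s) (V s ω j) ∂P x := by
  have := hV.prob x
  have hmz : ∀ t z, MeasurableSet {ω | V t ω = z} := fun t z =>
    hV.measurable t (measurableSet_singleton z)
  have hA' := IsMarkovChain.past_le hV.measurable s A hA
  have key : ((P x).restrict (A ∩ {ω | V s ω = z})).map (V t)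
      = P x (A ∩ {ω | V s ω = z}) • Measure.pi fun j => stepLaw (t - s) (z j) := by
    refine Measure.ext_of_singleton fun y => ?_
    rw [Measure.map_apply (hV.measurable t) (measurableSet_singleton y), Measure.smul_apply,
      pi_stepLaw_singleton, smul_eq_mul, mul_comm, ← (hV.isMarkovChain x).markov hst z y hA,
      Measure.restrict_apply (hV.measurable t (measurableSet_singleton y)), Set.inter_comm,
      Set.inter_assoc]
    rfl
  have hfm : Measurable fun y : Fin N → ℤ => f (y j) := by fun_prop
  have h1 : ∫ ω in A ∩ {ω | V s ω = z}, f (V t ω j) ∂P x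
      = (P x).real (A ∩ {ω | V s ω = z}) • ∫ n, f n ∂stepLaw (t - s) (z j) := by
    rw [← integral_map (hV.measurable t).aemeasurable (f := fun y : Fin N → ℤ => f (y j))
      hfm.aestronglyMeasurable, key, integral_smul_measure, measureReal_def,
      ← (measurePreserving_eval (fun j => stepLaw (t - s) (z j)) j).map_eq,
      integral_map (measurable_pi_apply j).aemeasurable (by fun_prop)]
  rw [h1, ← setIntegral_const]
  refine setIntegral_congr_fun (hA'.inter (hmz s z)) fun ω hω => ?_
  have : V s ω = z := hω.2
  simp only [this]

/-- Conditioning a function of `V_j(t)` on the joint past up to `s` averages it over `stepLaw`. -/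
lemma IsRandomWalkFamily.condExp_coord (hV : IsRandomWalkFamily P V) (x : Fin N → ℤ)
    {s t : ℝ≥0} (hst : s ≤ t) (j : Fin N) {f g : ℤ → ℂ} (hf : ExpBdd f) (hg : ExpBdd g)
    (hfg : ∀ n, ∫ m, f m ∂stepLaw (t - s) n = g n) :
    (P x)[fun ω => f (V t ω j) | natFiltration V hV.measurable s] =ᵐ[P x] fun ω => g (V s ω j) := by
  have := hV.prob x
  have hle := IsMarkovChain.past_le hV.measurable s
  refine (ae_eq_condExp_of_forall_setIntegral_eq (natFiltration V hV.measurable |>.le s)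
    (hV.integrable_coord x t j hf) (fun _ _ _ => (hV.integrable_coord x s j hg).integrableOn)
    (fun A hA _ => ?_) ?_).symm
  · have hA : MeasurableSet[IsMarkovChain.past V s] A := hA
    have hmz : ∀ z, MeasurableSet (A ∩ {ω | V s ω = z}) := fun z =>
      (hle A hA).inter (hV.measurable s (measurableSet_singleton z))
    have e : A = ⋃ z, A ∩ {ω | V s ω = z} := by ext ω; simp
    have hd : Pairwise (Function.onFun Disjoint fun z => A ∩ {ω | V s ω = z}) := fun z z' hzz' =>
      Set.disjoint_left.2 fun ω h h' => hzz' (h.2.symm.trans h'.2)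
    rw [e, integral_iUnion hmz hd (hV.integrable_coord x t j hf).integrableOn,
      integral_iUnion hmz hd (hV.integrable_coord x s j hg).integrableOn]
    refine tsum_congr fun z => ?_
    rw [hV.setIntegral_coord x hst j f z hA]
    simp only [hfg]
  · have h1 : StronglyMeasurable[IsMarkovChain.past V s] fun ω => g (V s ω j) := by
      have h2 : Measurable[IsMarkovChain.past V s] (V s) := fun B hB =>
        IsMarkovChain.measurableSet_past le_rfl B
      have h3 : Measurable fun y : Fin N → ℤ => g (y j) := by fun_prop
      exact (h3.comp h2).stronglyMeasurable
    exact h1.aestronglyMeasurable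

variable (u : Fin N → ℤ)

lemma integral_M (k : Fin N) {s t : ℝ≥0} (hst : s ≤ t) (n : ℤ) :
    ∫ m, M u k t m ∂stepLaw (t - s) n = M u k s n := by
  rw [integral_stepLaw _ (ExpBdd.M u k t), NNReal.coe_sub hst]
  have := besselSum_S (ExpBdd.Phi u k) s t n
  rw [M, ← this]
  push_cast
  rfl

lemma IsRandomWalkFamily.martingale_M (hV : IsRandomWalkFamily P V) (x : Fin N → ℤ)
    (j k : Fin N) :
    Martingale (fun t ω => M u k t (V t ω j)) (natFiltration V hV.measurable) (P x) := by
  refine ⟨fun t => ?_, fun s t hst => hV.condExp_coord x hst j (ExpBdd.M u k t) (ExpBdd.M u k s)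
    fun n => integral_M u k hst n⟩
  have h2 : Measurable[IsMarkovChain.past V t] (V t) := fun B hB =>
    IsMarkovChain.measurableSet_past le_rfl B
  have h3 : Measurable fun y : Fin N → ℤ => M u k t (y j) := by fun_prop
  exact (h3.comp h2).stronglyMeasurable

/-- The martingale property in the joint filtration descends to the filtration of one walk. -/
lemma IsRandomWalkFamily.martingale_M_coord (hV : IsRandomWalkFamily P V) (x : Fin N → ℤ)
    (j k : Fin N) :
    Martingale (fun t ω => M u k t (V t ω j)) (natFiltrationCoord V hV.measurable j) (P x) := by
  have := hV.prob x
  have hm := hV.martingale_M u x j k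
  have hsm : StronglyAdapted (natFiltrationCoord V hV.measurable j)
      fun t ω => M u k t (V t ω j) := fun t => by
    have h2 : Measurable[IsMarkovChain.past (fun t ω => V t ω j) t] fun ω => V t ω j :=
      fun B hB => IsMarkovChain.measurableSet_past (Y := fun t ω => V t ω j) le_rfl B
    have h3 : Measurable fun n : ℤ => M u k t n := by fun_prop
    exact (h3.comp h2).stronglyMeasurable
  refine ⟨hsm, fun s t hst => ?_⟩
  have hle : natFiltrationCoord V hV.measurable j s ≤ natFiltration V hV.measurable s := by
    refine iSup₂_mono fun r _ => ?_
    rintro _ ⟨B, hB, rfl⟩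
    exact ⟨(fun y : Fin N → ℤ => y j) ⁻¹' B, (Set.to_countable _).measurableSet, rfl⟩
  refine (condExp_condExp_of_le hle ((natFiltration V hV.measurable).le s)).symm.trans ?_
  refine (condExp_congr_ae (hm.2 s t hst)).trans ?_
  rw [condExp_of_stronglyMeasurable _ (hsm s) (hV.integrable_coord x s j (ExpBdd.M u k s))]

lemma IsRandomWalkFamily.integral_M (hV : IsRandomWalkFamily P V) (hu : u ∈ Chamber N)
    (j k : Fin N) (t : ℝ≥0) : ∫ ω, M u k t (V t ω j) ∂P u = if j = k then 1 else 0 := by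
  have := hV.prob u
  have h1 := (hV.martingale_M u u j k).setIntegral_eq (zero_le : (0 : ℝ≥0) ≤ t) MeasurableSet.univ
  simp only [Measure.restrict_univ] at h1
  rw [← h1, ← Phi_apply hu j k, ← M_zero]
  rw [integral_congr_ae (g := fun _ => M u k 0 (u j)) ?_]
  · simp
  · filter_upwards [(hV.coord u j).start] with ω hω
    rw [hω]

lemma IsRandomWalkFamily.satisfiesM (hV : IsRandomWalkFamily P V) (hu : u ∈ Chamber N) :
    SatisfiesM P V hV.measurable u (M u) where
  m1 x j k := hV.martingale_M_coord u x j k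
  m1_joint x j k := hV.martingale_M u x j k
  m2 t := linearIndependent_M hu t
  m3 j k := by
    simp only [hV.integral_M u hu j k]
    exact tendsto_const_nhds
  m3_all j k t := hV.integral_M u hu j k t

end Walk

/-! ### Small-time estimates -/

section

lemma summable_besselI (n : ℕ) (z : ℝ) :
    Summable fun l : ℕ => (z / 2) ^ (2 * l) / ((l.factorial : ℝ) * Real.Gamma (n + l + 1)) := by
  refine Summable.of_nonneg_of_le (fun l => ?_) (fun l => ?_)
    (Real.summable_pow_div_factorial ((z / 2) ^ 2))
  · rw [pow_mul]
    have := Real.Gamma_pos_of_pos (show (0 : ℝ) < n + l + 1 by positivity)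
    positivity
  · rw [pow_mul]
    have h1 : (1 : ℝ) ≤ Real.Gamma (n + l + 1) := by
      have : Real.Gamma (n + l + 1) = ((n + l).factorial : ℝ) := by
        rw [← Real.Gamma_nat_eq_factorial]; push_cast; rfl
      rw [this]
      exact_mod_cast Nat.one_le_iff_ne_zero.2 (Nat.factorial_ne_zero _)
    have h2 : (0 : ℝ) < l.factorial := by exact_mod_cast l.factorial_pos
    gcongr
    exact le_mul_of_one_le_right h2.le h1

lemma le_besselI (n : ℕ) {z : ℝ} (hz : 0 ≤ z) : (z / 2) ^ n / n.factorial ≤ besselI n z := by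
  have h1 : ((n.factorial : ℝ))⁻¹ ≤
      ∑' l : ℕ, (z / 2) ^ (2 * l) / ((l.factorial : ℝ) * Real.Gamma (n + l + 1)) := by
    refine le_trans (le_of_eq ?_) ((summable_besselI n z).le_tsum 0 fun l _ => ?_)
    · simp [Real.Gamma_nat_eq_factorial]
    · have := Real.Gamma_pos_of_pos (show (0 : ℝ) < n + l + 1 by positivity)
      positivity
  rw [besselI, div_eq_mul_inv]
  gcongr

lemma le_stepProb_zero (t : ℝ≥0) : Real.exp (-t) ≤ stepProb t 0 := by
  have := le_besselI 0 t.2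
  rw [stepProb]
  refine le_mul_of_one_le_right (Real.exp_pos _).le ?_
  simpa using this

lemma le_stepProb_one (t : ℝ≥0) {n : ℤ} (hn : n.natAbs = 1) :
    Real.exp (-t) * (t / 2) ≤ stepProb t n := by
  have := le_besselI 1 t.2
  rw [stepProb, hn]
  gcongr
  simpa using this

lemma stepProb_neg (t : ℝ≥0) (n : ℤ) : stepProb t (-n) = stepProb t n := by
  rw [stepProb, Int.natAbs_neg, stepProb]

lemma stepLaw_real_singleton (t : ℝ≥0) (x n : ℤ) : (stepLaw t x).real {n} = stepProb t (n - x) := by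
  rw [measureReal_def, stepLaw_singleton, ENNReal.toReal_ofReal (stepProb_nonneg _ _)]

/-- The walk jumps at all with probability at most `t`. -/
lemma stepLaw_ne_le (t : ℝ≥0) (x : ℤ) : (stepLaw t x).real {n | n ≠ x} ≤ t := by
  have h1 : {n | n ≠ x} = {x}ᶜ := rfl
  rw [h1, probReal_compl_eq_one_sub (measurableSet_singleton x), stepLaw_real_singleton, sub_self]
  have := le_stepProb_zero t
  have := Real.add_one_le_exp (-(t : ℝ))
  linarith

/-- The walk moves by at least two with probability at most `t ^ 2`. -/
lemma stepLaw_far_le (t : ℝ≥0) (x : ℤ) :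
    (stepLaw t x).real {n | 2 ≤ (n - x).natAbs} ≤ (t : ℝ) ^ 2 := by
  have h1 : {n | 2 ≤ (n - x).natAbs} = (({x, x + 1, x - 1} : Finset ℤ) : Set ℤ)ᶜ := by
    ext n
    simp
    omega
  rw [h1, probReal_compl_eq_one_sub (Set.to_countable _).measurableSet,
    ← sum_measureReal_singleton, Finset.sum_insert (by simp; omega), Finset.sum_pair (by omega)]
  simp only [stepLaw_real_singleton]
  have h2 := le_stepProb_zero t
  have h3 := le_stepProb_one t (n := x + 1 - x) (by simp)
  have h4 := le_stepProb_one t (n := x - 1 - x) (by simp)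
  have h5 := Real.add_one_le_exp (-(t : ℝ))
  rw [sub_self]
  have ht : (0 : ℝ) ≤ t := t.2
  nlinarith

variable {N : ℕ}

/-- Two coordinates move, or one moves by at least two, with probability `O(t ^ 2)`. -/
lemma pi_stepLaw_far_le (t : ℝ≥0) (y : Fin N → ℤ) :
    (Measure.pi fun j => stepLaw t (y j)).real {z | (∃ i, 2 ≤ (z i - y i).natAbs) ∨
      ∃ i j, i ≠ j ∧ z i ≠ y i ∧ z j ≠ y j} ≤ (N + N ^ 2 : ℝ) * (t : ℝ) ^ 2 := by
  set μ := Measure.pi fun j => stepLaw t (y j)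
  have h1 : ∀ i, μ.real {z | 2 ≤ (z i - y i).natAbs} ≤ (t : ℝ) ^ 2 := fun i => by
    have := (measurePreserving_eval (fun j => stepLaw t (y j)) i).measureReal_preimage
      (s := {n : ℤ | 2 ≤ (n - y i).natAbs}) (Set.to_countable _).measurableSet.nullMeasurableSet
    refine (le_of_eq ?_).trans (stepLaw_far_le t (y i))
    exact this
  have h2 : ∀ i j, μ.real {z | i ≠ j ∧ z i ≠ y i ∧ z j ≠ y j} ≤ (t : ℝ) ^ 2 := fun i j => by
    by_cases hij : i = j
    · simp only [hij, ne_eq, not_true_eq_false, false_and, Set.ofPred_false, measureReal_empty]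
      positivity
    have e : {z | i ≠ j ∧ z i ≠ y i ∧ z j ≠ y j}
        = Set.univ.pi fun k => if k = i ∨ k = j then {n | n ≠ y k} else Set.univ := by
      ext z
      simp only [Set.mem_ofPred_eq, Set.mem_univ_pi]
      refine ⟨fun h k => ?_, fun h => ⟨hij, ?_, ?_⟩⟩
      · split_ifs with hk
        · rcases hk with rfl | rfl
          exacts [h.2.1, h.2.2]
        · trivial
      · simpa using h i
      · simpa using h j
    rw [e, measureReal_def, Measure.pi_pi, ENNReal.toReal_prod,
      Finset.prod_eq_mul i j hij (fun k _ hk => by simp [hk.1, hk.2]) (by simp) (by simp), sq]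
    simp only [true_or, or_true, if_true]
    exact mul_le_mul (stepLaw_ne_le t _) (stepLaw_ne_le t _) measureReal_nonneg t.2
  have h3 : {z : Fin N → ℤ | (∃ i, 2 ≤ (z i - y i).natAbs) ∨ ∃ i j, i ≠ j ∧ z i ≠ y i ∧ z j ≠ y j}
      = (⋃ i, {z | 2 ≤ (z i - y i).natAbs}) ∪
        ⋃ p : Fin N × Fin N, {z | p.1 ≠ p.2 ∧ z p.1 ≠ y p.1 ∧ z p.2 ≠ y p.2} := by
    ext z
    simp only [Set.mem_union, Set.mem_iUnion, Set.mem_ofPred_eq, Prod.exists]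
  rw [h3]
  refine (measureReal_union_le _ _).trans ?_
  rw [add_mul]
  refine add_le_add ((measureReal_iUnion_fintype_le _).trans ?_)
    ((measureReal_iUnion_fintype_le _).trans ?_)
  · refine (Finset.sum_le_sum fun i _ => h1 i).trans (by simp)
  · refine (Finset.sum_le_sum fun p _ => h2 p.1 p.2).trans (by simp [sq])

/-! ### The Karlin–McGregor determinant -/

lemma freeProb_comm (t : ℝ≥0) (x y : Fin N → ℤ) : freeProb t x y = freeProb t y x :=
  Finset.prod_congr rfl fun j _ => by rw [← stepProb_neg, neg_sub]

lemma freeProb_comp (t : ℝ≥0) (x y : Fin N → ℤ) (σ : Equiv.Perm (Fin N)) :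
    freeProb t (x ∘ σ) (y ∘ σ) = freeProb t x y :=
  Equiv.prod_comp σ fun j => stepProb t (y j - x j)

lemma freeProb_comp_left (t : ℝ≥0) (x y : Fin N → ℤ) (σ : Equiv.Perm (Fin N)) :
    freeProb t (x ∘ σ) y = freeProb t x (y ∘ ⇑σ⁻¹) := by
  rw [← freeProb_comp t x _ σ]
  congr 1
  funext j
  simp

lemma pi_stepLaw_real_singleton (t : ℝ≥0) (x y : Fin N → ℤ) :
    (Measure.pi fun j => stepLaw t (x j)).real {y} = freeProb t x y := by
  rw [measureReal_def, pi_stepLaw_singleton, ENNReal.toReal_ofReal (freeProb_nonneg _ _ _)]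

lemma hasSum_freeProb_indicator (t : ℝ≥0) (x : Fin N → ℤ) (B : Set (Fin N → ℤ)) :
    HasSum (B.indicator (freeProb t x)) ((Measure.pi fun j => stepLaw t (x j)).real B) := by
  set μ := Measure.pi fun j => stepLaw t (x j)
  have h1 : ∑' y, B.indicator (fun y => μ {y}) y = μ B :=
    Measure.tsum_indicator_apply_singleton μ B (Set.to_countable _).measurableSet
  have h2 : ∑' y, B.indicator (fun y => μ {y}) y ≠ ∞ := h1 ▸ measure_ne_top _ _
  have h3 := ENNReal.hasSum_toReal h2
  rw [← ENNReal.tsum_toReal_eq fun z => ENNReal.ne_top_of_tsum_ne_top h2 z, h1] at h3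
  convert! h3 using 2 with y
  by_cases hy : y ∈ B
  · rw [Set.indicator_of_mem hy, Set.indicator_of_mem hy, ← pi_stepLaw_real_singleton]; rfl
  · simp [hy]

lemma hasSum_freeProb_one (t : ℝ≥0) (x : Fin N → ℤ) : HasSum (freeProb t x) 1 := by
  simpa using hasSum_freeProb_indicator t x Set.univ

lemma freeProb_le_one (t : ℝ≥0) (x y : Fin N → ℤ) : freeProb t x y ≤ 1 := by
  rw [← pi_stepLaw_real_singleton]
  exact measureReal_le_one

/-- The determinant `det [p_t(x_j, y_k)]`, written as a signed sum over permutations. -/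
noncomputable def kmDet (t : ℝ≥0) (x y : Fin N → ℤ) : ℝ :=
  ∑ σ : Equiv.Perm (Fin N), ((Equiv.Perm.sign σ : ℤ) : ℝ) * freeProb t x (y ∘ σ)

lemma abs_kmDet_le (t : ℝ≥0) (x y : Fin N → ℤ) : |kmDet t x y| ≤ N.factorial := by
  refine (Finset.abs_sum_le_sum_abs _ _).trans ?_
  refine (Finset.sum_le_sum (g := fun _ => (1 : ℝ)) fun σ _ => ?_).trans ?_
  · rw [abs_mul, abs_of_nonneg (freeProb_nonneg _ _ _), ← Int.cast_abs, Int.abs_eq_natAbs,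
      Int.units_natAbs]
    simpa using freeProb_le_one _ _ _
  · simp [Fintype.card_perm]

lemma kmDet_comp_right (t : ℝ≥0) (x y : Fin N → ℤ) (ρ : Equiv.Perm (Fin N)) :
    kmDet t x (y ∘ ρ) = ((Equiv.Perm.sign ρ : ℤ) : ℝ) * kmDet t x y := by
  conv_rhs => rw [kmDet, ← Equiv.sum_comp (Equiv.mulLeft ρ), Finset.mul_sum]
  refine Finset.sum_congr rfl fun σ _ => ?_
  simp only [Equiv.coe_mulLeft, Equiv.Perm.sign_mul, Units.val_mul, Int.cast_mul,
    Equiv.Perm.coe_mul]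
  rw [← mul_assoc, ← mul_assoc, ← Int.cast_mul, ← Units.val_mul, Int.units_mul_self]
  simp [Function.comp_assoc]

lemma kmDet_comp_left (t : ℝ≥0) (x y : Fin N → ℤ) (ρ : Equiv.Perm (Fin N)) :
    kmDet t (x ∘ ρ) y = ((Equiv.Perm.sign ρ : ℤ) : ℝ) * kmDet t x y := by
  rw [kmDet, kmDet, ← Equiv.sum_comp (Equiv.mulRight ρ), Finset.mul_sum]
  refine Finset.sum_congr rfl fun σ _ => ?_
  simp only [Equiv.coe_mulRight, Equiv.Perm.sign_mul, Units.val_mul, Int.cast_mul,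
    Equiv.Perm.coe_mul]
  rw [freeProb_comp_left]
  have : (y ∘ (⇑σ ∘ ⇑ρ)) ∘ ⇑ρ⁻¹ = y ∘ ⇑σ := by funext j; simp
  rw [this]; ring

lemma comp_swap_eq {x : Fin N → ℤ} {i j : Fin N} (hij : x i = x j) : x ∘ Equiv.swap i j = x := by
  funext k
  simp only [Function.comp_apply, Equiv.swap_apply_def]
  split_ifs with h h'
  · rw [h, hij]
  · rw [h', hij]
  · rfl

/-- The determinant vanishes on the walls of the chamber. -/
lemma kmDet_eq_zero (t : ℝ≥0) (x : Fin N → ℤ) {y : Fin N → ℤ} (hy : ¬ Function.Injective y) :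
    kmDet t x y = 0 := by
  simp only [Function.Injective, not_forall] at hy
  obtain ⟨i, j, hij, hne⟩ := hy
  have h1 := kmDet_comp_right t x y (Equiv.swap i j)
  rw [comp_swap_eq hij, Equiv.Perm.sign_swap hne] at h1
  simp at h1
  linarith

lemma kmDet_eq_zero_left (t : ℝ≥0) {x : Fin N → ℤ} (y : Fin N → ℤ) (hx : ¬ Function.Injective x) :
    kmDet t x y = 0 := by
  simp only [Function.Injective, not_forall] at hx
  obtain ⟨i, j, hij, hne⟩ := hx
  have h1 := kmDet_comp_left t x y (Equiv.swap i j)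
  rw [comp_swap_eq hij, Equiv.Perm.sign_swap hne] at h1
  simp at h1
  linarith

/-- If `y` lies in the chamber and `z` has distinct coordinates but lies outside, then at least two
unit jumps separate `z` from `y`. -/
lemma far_of_notMem_chamber {y z : Fin N → ℤ} (hy : y ∈ Chamber N) (hz : z ∉ Chamber N)
    (hi : Function.Injective z) :
    (∃ i, 2 ≤ (z i - y i).natAbs) ∨ ∃ i j, i ≠ j ∧ z i ≠ y i ∧ z j ≠ y j := by
  have : ∃ i j, i < j ∧ z j ≤ z i := by
    by_contra! hcon
    exact hz fun i j hij => hcon i j hij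
  obtain ⟨i, j, hij, hle⟩ := this
  have h1 : z j ≠ z i := fun h => hij.ne' (hi h)
  have h2 : y i < y j := hy hij
  by_cases hi' : 2 ≤ (z i - y i).natAbs
  · exact Or.inl ⟨i, hi'⟩
  by_cases hj' : 2 ≤ (z j - y j).natAbs
  · exact Or.inl ⟨j, hj'⟩
  exact Or.inr ⟨i, j, hij.ne, by omega, by omega⟩

lemma stepProb_zero_time {n : ℤ} (hn : n ≠ 0) : stepProb 0 n = 0 := by
  simp [stepProb, besselI, hn]

lemma freeProb_zero_time {x y : Fin N → ℤ} (hxy : x ≠ y) : freeProb 0 x y = 0 := by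
  obtain ⟨j, hj⟩ := Function.ne_iff.1 hxy
  exact Finset.prod_eq_zero (Finset.mem_univ j) (stepProb_zero_time (sub_ne_zero.2 hj.symm))

lemma perm_eq_one_of_chamber {x y : Fin N → ℤ} (hx : x ∈ Chamber N) (hy : y ∈ Chamber N)
    {σ : Equiv.Perm (Fin N)} (h : x = y ∘ σ) : σ = 1 := by
  have hx : StrictMono x := hx
  have hy : StrictMono y := hy
  have h1 : StrictMono σ := fun i j hij => hy.lt_iff_lt.1 (by
    have := hx hij
    rw [h] at this
    exact this)
  have h2 : (σ : Fin N → Fin N) = id := (h1.range_inj strictMono_id).1 (by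
    rw [Set.range_id, σ.surjective.range_eq])
  exact Equiv.ext fun i => congrFun h2 i

lemma kmDet_zero_time {x y : Fin N → ℤ} (hx : x ∈ Chamber N) (hy : y ∈ Chamber N) :
    kmDet 0 x y = freeProb 0 x y := by
  rw [kmDet, Finset.sum_eq_single 1]
  · simp
  · intro σ _ hσ
    rw [freeProb_zero_time fun h => hσ (perm_eq_one_of_chamber hx hy h), mul_zero]
  · simp

section Walk
variable {Ω : Type*} [MeasurableSpace Ω] {P : (Fin N → ℤ) → Measure Ω} {V : ℝ≥0 → Ω → Fin N → ℤ}

lemma IsRandomWalkFamily.real_apply_eq (hV : IsRandomWalkFamily P V) (t : ℝ≥0) (x y : Fin N → ℤ) :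
    (P x).real {ω | V t ω = y} = freeProb t x y := by
  rw [measureReal_def, (hV.isMarkovChain x).apply_eq, ENNReal.toReal_ofReal (freeProb_nonneg _ _ _)]

lemma IsRandomWalkFamily.hasSum_markov (hV : IsRandomWalkFamily P V) (x : Fin N → ℤ) {s t : ℝ≥0}
    (hst : s ≤ t) (y : Fin N → ℤ) {A : Set Ω} (hA : MeasurableSet[IsMarkovChain.past V s] A) :
    HasSum (fun z => (P x).real (A ∩ {ω | V s ω = z}) * freeProb (t - s) z y)
      ((P x).real (A ∩ {ω | V t ω = y})) := by
  have := (hV.isMarkovChain x).hasSum_markov hst y hA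
  simpa only [ENNReal.toReal_ofReal (freeProb_nonneg _ _ _)] using this

lemma IsRandomWalkFamily.hasSum_freeProb (hV : IsRandomWalkFamily P V) (s t : ℝ≥0)
    (x y : Fin N → ℤ) :
    HasSum (fun z => freeProb s x z * freeProb t z y) (freeProb (s + t) x y) := by
  have := hV.hasSum_markov x (le_add_of_nonneg_right (zero_le : 0 ≤ t)) y (s := s)
    MeasurableSet.univ
  simpa only [Set.univ_inter, hV.real_apply_eq, add_tsub_cancel_left] using this

/-- The Chapman–Kolmogorov equation for the determinant and the free transition probabilities. -/
lemma IsRandomWalkFamily.hasSum_kmDet (hV : IsRandomWalkFamily P V) (s t : ℝ≥0)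
    (x y : Fin N → ℤ) :
    HasSum (fun z => kmDet s x z * freeProb t z y) (kmDet (s + t) x y) := by
  simp only [kmDet, Finset.sum_mul]
  refine hasSum_sum fun σ _ => ?_
  simp only [mul_assoc]
  refine HasSum.mul_left _ ?_
  have h1 := hV.hasSum_freeProb s t x (y ∘ σ)
  rw [← (Equiv.arrowCongr σ (Equiv.refl ℤ)).hasSum_iff]
  convert! h1 using 2 with z
  have h2 : (Equiv.arrowCongr σ (Equiv.refl ℤ)) z = z ∘ ⇑σ⁻¹ := rfl
  simp only [Function.comp_apply, h2]
  rw [freeProb_comp_left, inv_inv]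
  congr 2
  funext j; simp

lemma measurableSet_grid {Ω : Type*} {V : ℝ≥0 → Ω → Fin N → ℤ} (s : ℝ≥0) (n : ℕ) :
    MeasurableSet[IsMarkovChain.past V (n * s)] {ω | ∀ k ≤ n, V (k * s) ω ∈ Chamber N} := by
  have : {ω | ∀ k ≤ n, V (k * s) ω ∈ Chamber N} = ⋂ k, ⋂ (_ : k ≤ n), V (k * s) ⁻¹' Chamber N := by
    ext ω; simp
  rw [this]
  refine MeasurableSet.iInter fun k => MeasurableSet.iInter fun hk =>
    IsMarkovChain.measurableSet_past ?_ _
  gcongr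

/-- The walk observed on a grid of mesh `s` and killed on leaving the chamber has transition
probabilities close to the Karlin–McGregor determinant: each step contributes an error only from
jumps over a wall of the chamber, which have probability `O(s ^ 2)`. -/
lemma IsRandomWalkFamily.grid_error (hV : IsRandomWalkFamily P V) {x : Fin N → ℤ}
    (hx : x ∈ Chamber N) (s : ℝ≥0) (n : ℕ) : ∀ y ∈ Chamber N,
    |kmDet (n * s) x y - (P x).real ({ω | ∀ k ≤ n, V (k * s) ω ∈ Chamber N} ∩
      {ω | V (n * s) ω = y})| ≤ n * (N.factorial * ((N + N ^ 2 : ℝ) * (s : ℝ) ^ 2)) := by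
  have := hV.prob x
  set ε : ℝ := N.factorial * ((N + N ^ 2 : ℝ) * (s : ℝ) ^ 2) with hε
  have hε0 : 0 ≤ ε := by positivity
  induction n with
  | zero =>
    intro y hy
    have e : {ω | ∀ k : ℕ, k ≤ 0 → V (k * s) ω ∈ Chamber N} ∩ {ω | V ((0 : ℕ) * s) ω = y}
        = {ω | V 0 ω = y} := by
      ext ω
      simp only [nonpos_iff_eq_zero, forall_eq, Nat.cast_zero, zero_mul, Set.mem_inter_iff,
        Set.mem_ofPred_eq, and_iff_right_iff_imp]
      rintro rfl
      exact hy
    rw [e, hV.real_apply_eq]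
    simp [kmDet_zero_time hx hy]
  | succ n ih =>
    intro y hy
    have hadd : ((n + 1 : ℕ) : ℝ≥0) * s = n * s + s := by push_cast; ring
    have e : {ω | ∀ k ≤ n + 1, V (k * s) ω ∈ Chamber N} ∩ {ω | V ((n + 1 : ℕ) * s) ω = y}
        = {ω | ∀ k ≤ n, V (k * s) ω ∈ Chamber N} ∩ {ω | V (n * s + s) ω = y} := by
      ext ω
      simp only [Set.mem_inter_iff, Set.mem_ofPred_eq, hadd]
      refine and_congr_left fun h => ⟨fun h' k hk => h' k (hk.trans n.le_succ), fun h' k hk => ?_⟩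
      rcases Nat.le_succ_iff.1 hk with hk | rfl
      · exact h' k hk
      · rw [Nat.succ_eq_add_one, hadd, h]; exact hy
    -- The killed and the determinantal weights evolve by the same free step; they differ in that
    -- the killed weight is zero outside the chamber.
    have h1 := hV.hasSum_markov x (le_add_of_nonneg_right (zero_le : 0 ≤ s)) y
      (measurableSet_grid (V := V) s n)
    rw [add_tsub_cancel_left] at h1
    have h2 := (hV.hasSum_kmDet (n * s) s x y).sub h1
    set B := {z : Fin N → ℤ | (∃ i, 2 ≤ (z i - y i).natAbs) ∨
      ∃ i j, i ≠ j ∧ z i ≠ y i ∧ z j ≠ y j}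
    have h3 := ((hasSum_freeProb_one s y).mul_left (n * ε)).add
      ((hasSum_freeProb_indicator s y B).mul_left (N.factorial : ℝ))
    rw [e, hadd]
    refine (h2.norm_le_of_bounded h3 fun z => ?_).trans ?_
    · rw [← sub_mul, norm_mul, Real.norm_of_nonneg (freeProb_nonneg _ _ _), Real.norm_eq_abs]
      have hp := freeProb_nonneg s y z
      have hind : 0 ≤ B.indicator (freeProb s y) z := Set.indicator_nonneg (fun z _ =>
        freeProb_nonneg _ _ _) z
      rw [freeProb_comm s z y]
      by_cases hz : z ∈ Chamber N
      · have := mul_le_mul_of_nonneg_right (ih z hz) hp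
        refine this.trans (le_add_of_nonneg_right (by positivity))
      · have h0 : {ω | ∀ k ≤ n, V (k * s) ω ∈ Chamber N} ∩ {ω | V (n * s) ω = z} = ∅ := by
          ext ω
          simp only [Set.mem_inter_iff, Set.mem_ofPred_eq, Set.mem_empty_iff_false, iff_false,
            not_and]
          intro h h'
          exact hz (h' ▸ h n le_rfl)
        rw [h0, measureReal_empty, sub_zero]
        by_cases hi : Function.Injective z
        · have hB : z ∈ B := far_of_notMem_chamber hy hz hi
          rw [Set.indicator_of_mem hB]
          have := mul_le_mul_of_nonneg_right (abs_kmDet_le (n * s) x z) hp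
          exact this.trans (le_add_of_nonneg_left (by positivity))
        · rw [kmDet_eq_zero _ _ hi]
          simp only [abs_zero, zero_mul]
          positivity
    · have := mul_le_mul_of_nonneg_left (pi_stepLaw_far_le s y)
        (Nat.cast_nonneg (α := ℝ) N.factorial)
      push_cast
      rw [add_mul, mul_one, one_mul]
      exact add_le_add_right this _

/-! ### From the grid to the exit time -/

/-- A dyadic grid point of `[0, t]` in a given right neighbourhood of `s < t`. -/
lemma exists_dyadic_mem {s t b : ℝ≥0} (hst : s < t) (hsb : s < b) :
    ∃ m k : ℕ, k ≤ 2 ^ m ∧ s ≤ k * (t / 2 ^ m) ∧ k * (t / 2 ^ m) < b := by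
  have ht : (0 : ℝ) < t := lt_of_le_of_lt s.2 hst
  have hst' : (s : ℝ) < t := hst
  have hsb' : (s : ℝ) < b := hsb
  have hd : 0 < min (b : ℝ) t - s := sub_pos.2 (lt_min hsb' hst')
  obtain ⟨m, hm⟩ := pow_unbounded_of_one_lt ((t : ℝ) / (min (b : ℝ) t - s)) one_lt_two
  have hm' : (t : ℝ) / 2 ^ m < min (b : ℝ) t - s := by
    rw [div_lt_iff₀ hd] at hm
    rw [div_lt_iff₀ (by positivity)]
    linarith
  have hpos : (0 : ℝ) < t / 2 ^ m := by positivity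
  set k := ⌈(s : ℝ) / (t / 2 ^ m)⌉₊
  have h1 : (s : ℝ) / (t / 2 ^ m) ≤ k := Nat.le_ceil _
  have h2 : (k : ℝ) < (s : ℝ) / (t / 2 ^ m) + 1 := Nat.ceil_lt_add_one (div_nonneg s.2 hpos.le)
  have h3 : (s : ℝ) ≤ k * (t / 2 ^ m) := (div_le_iff₀ hpos).1 h1
  have h4 : (k : ℝ) * (t / 2 ^ m) < s + t / 2 ^ m := by
    have := mul_lt_mul_of_pos_right h2 hpos
    rwa [add_mul, div_mul_cancel₀ _ hpos.ne', one_mul] at this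
  have h5 : (k : ℝ) * (t / 2 ^ m) < min (b : ℝ) t := by linarith
  refine ⟨m, k, ?_, ?_, ?_⟩
  · have h6 : (k : ℝ) * t < 2 ^ m * t := by
      have := h5.trans_le (min_le_right _ _)
      rw [← mul_div_assoc, div_lt_iff₀ (by positivity)] at this
      linarith
    have h7 : (k : ℝ) < 2 ^ m := lt_of_mul_lt_mul_right h6 ht.le
    exact_mod_cast h7.le
  · rw [← NNReal.coe_le_coe]; push_cast; exact h3
  · rw [← NNReal.coe_lt_coe]; push_cast; exact h5.trans_le (min_le_left _ _)

/-- Càdlàg lattice paths are constant for a positive time. -/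
lemma IsCadlagPath.eventually_eq {f : ℝ≥0 → Fin N → ℤ}
    (hf : ∀ j, IsCadlagPath fun t => f t j) (t : ℝ≥0) :
    ∃ b > t, ∀ r, t ≤ r → r < b → f r = f t := by
  have h1 : ∀ᶠ r in 𝓝[≥] t, f r = f t := by
    have : ∀ j, ∀ᶠ r in 𝓝[≥] t, f r j = f t j := fun j => by
      have := (hf j t).1
      rw [ContinuousWithinAt, nhds_discrete, tendsto_pure] at this
      exact this
    filter_upwards [eventually_all.2 this] with r hr
    exact funext hr
  obtain ⟨b, hb, h⟩ := (mem_nhdsGE_iff_exists_Ico_subset' (show t < t + 1 by simp)).1 h1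
  exact ⟨b, hb, fun r h1 h2 => h ⟨h1, h2⟩⟩

/-- By right-continuity, the dyadic grids of `[0, t]` detect any exit from the chamber up to `t`. -/
lemma lt_exitTime_iff {Ω : Type*} {f : ℝ≥0 → Ω → Fin N → ℤ} {ω : Ω}
    (hf : ∀ j, IsCadlagPath fun t => f t ω j) (t : ℝ≥0) :
    (t : ℝ≥0∞) < exitTime f ω ↔
      ∀ m k : ℕ, k ≤ 2 ^ m → f (k * (t / 2 ^ m)) ω ∈ Chamber N := by
  refine ⟨fun h m k hk => ?_, fun h => ?_⟩
  · by_contra hcon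
    have h1 : exitTime f ω ≤ ((k * (t / 2 ^ m) : ℝ≥0) : ℝ≥0∞) :=
      sInf_le ⟨_, hcon, rfl⟩
    have h2 : (k : ℝ≥0) * (t / 2 ^ m) ≤ t := by
      rw [← mul_div_assoc, mul_comm, mul_div_assoc]
      refine mul_le_of_le_one_right zero_le (div_le_one_of_le₀ ?_ zero_le)
      exact_mod_cast hk
    exact absurd (h.trans_le h1) (not_lt.2 (by exact_mod_cast h2))
  · have h1 : ∀ s ≤ t, f s ω ∈ Chamber N := by
      intro s hs
      rcases hs.lt_or_eq with hs | rfl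
      · obtain ⟨b, hb, hfb⟩ := IsCadlagPath.eventually_eq hf s
        obtain ⟨m, k, hk, h2, h3⟩ := exists_dyadic_mem hs hb
        rw [← hfb _ h2 h3]
        exact h m k hk
      · simpa using h 0 1 le_rfl
    obtain ⟨b, hb, hfb⟩ := IsCadlagPath.eventually_eq hf t
    refine lt_of_lt_of_le (ENNReal.coe_lt_coe.2 hb) (le_sInf ?_)
    rintro _ ⟨r, hr, rfl⟩
    refine ENNReal.coe_le_coe.2 (le_of_not_gt fun hrb => hr ?_)
    rcases le_total r t with h2 | h2
    · exact h1 r h2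
    · rw [hfb r h2 hrb]; exact h1 t le_rfl

/-- The Karlin–McGregor formula for the walk absorbed on leaving the chamber. -/
theorem IsRandomWalkFamily.absorbedTransition_eq (hV : IsRandomWalkFamily P V) {x y : Fin N → ℤ}
    (hx : x ∈ Chamber N) (hy : y ∈ Chamber N) (t : ℝ≥0) :
    absorbedTransition P V t x y = kmDet t x y := by
  have := hV.prob x
  -- `A m` asks for no exit at the times `k t / 2 ^ m`; these events decrease in `m`.
  let A : ℕ → Set Ω := fun m =>
    {ω | ∀ k : ℕ, k ≤ 2 ^ m → V (k * (t / 2 ^ m)) ω ∈ Chamber N} ∩ {ω | V t ω = y}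
  have hmul : ∀ m : ℕ, ((2 ^ m : ℕ) : ℝ≥0) * (t / 2 ^ m) = t := fun m => by
    push_cast
    exact mul_div_cancel₀ t (by positivity)
  have hAm : ∀ m, MeasurableSet (A m) := fun m =>
    (IsMarkovChain.past_le hV.measurable _ _
      (measurableSet_grid (V := V) (t / 2 ^ m) (2 ^ m))).inter
        (hV.measurable t (measurableSet_singleton y))
  have hanti : Antitone A := antitone_nat_of_succ_le fun m ω hω => by
    refine ⟨fun k hk => ?_, hω.2⟩
    have h1 := hω.1 (2 * k) (by rw [pow_succ]; omega)
    have h2 : ((2 * k : ℕ) : ℝ≥0) * (t / 2 ^ (m + 1)) = k * (t / 2 ^ m) := by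
      push_cast
      rw [pow_succ]
      field_simp
    rwa [h2] at h1
  have hev : (P x) {ω | V t ω = y ∧ (t : ℝ≥0∞) < exitTime V ω} = P x (⋂ m, A m) := by
    refine measure_congr ?_
    filter_upwards [ae_all_iff.2 fun j => (hV.coord x j).cadlag] with ω hω
    refine propext ?_
    have h1 : ω ∈ ⋂ m, A m ↔ V t ω = y ∧
        ∀ m k : ℕ, k ≤ 2 ^ m → V (k * (t / 2 ^ m)) ω ∈ Chamber N := by
      simp only [A, Set.mem_iInter, Set.mem_inter_iff, Set.mem_ofPred_eq]
      exact ⟨fun h => ⟨(h 0).2, fun m => (h m).1⟩, fun h m => ⟨h.2 m, h.1⟩⟩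
    refine Iff.trans ?_ h1.symm
    exact and_congr_right fun _ => lt_exitTime_iff hω t
  have hlim : Tendsto (fun m => (P x).real (A m)) atTop (𝓝 (absorbedTransition P V t x y)) := by
    rw [absorbedTransition, measureReal_def, hev]
    exact (ENNReal.tendsto_toReal (measure_ne_top _ _)).comp
      (tendsto_measure_iInter_atTop (fun m => (hAm m).nullMeasurableSet) hanti
        ⟨0, measure_ne_top _ _⟩)
  have hlim2 : Tendsto (fun m => (P x).real (A m)) atTop (𝓝 (kmDet t x y)) := by
    have h1 : ∀ m, |kmDet t x y - (P x).real (A m)| ≤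
        (N.factorial * (N + N ^ 2 : ℝ) * (t : ℝ) ^ 2) * (1 / 2) ^ m := fun m => by
      have h2 := hV.grid_error hx (t / 2 ^ m) (2 ^ m) y hy
      rw [hmul] at h2
      refine h2.trans (le_of_eq ?_)
      push_cast
      have : (2 : ℝ) ^ m ≠ 0 := by positivity
      rw [one_div, inv_pow]
      field_simp
    have h3 : Tendsto (fun m : ℕ => (N.factorial * (N + N ^ 2 : ℝ) * (t : ℝ) ^ 2) * (1 / 2) ^ m)
        atTop (𝓝 0) := by
      simpa using (tendsto_pow_atTop_nhds_zero_of_lt_one (r := (1 / 2 : ℝ)) (by norm_num)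
        (by norm_num)).const_mul (N.factorial * (N + N ^ 2 : ℝ) * (t : ℝ) ^ 2)
    rw [tendsto_iff_norm_sub_tendsto_zero]
    refine squeeze_zero (fun _ => norm_nonneg _) (fun m => ?_) h3
    rw [Real.norm_eq_abs, abs_sub_comm]
    exact h1 m
  exact tendsto_nhds_unique hlim hlim2

end Walk

end

/-! ### Folding sums onto the chamber -/

section Fold
variable {N : ℕ}

/-- A point with distinct coordinates is brought into the chamber by exactly one permutation. -/
lemma sum_indicator_chamber {z : Fin N → ℤ} (hz : Function.Injective z) (c : ℝ) :
    ∑ σ : Equiv.Perm (Fin N), (Set.indicator {z | z ∘ ⇑σ⁻¹ ∈ Chamber N} (fun _ => c) z) = c := by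
  have hτ : z ∘ Tuple.sort z ∈ Chamber N :=
    (Tuple.monotone_sort z).strictMono_of_injective (hz.comp (Tuple.sort z).injective)
  rw [Finset.sum_eq_single (Tuple.sort z)⁻¹]
  · rw [Set.indicator_of_mem]
    simpa using hτ
  · intro σ _ hσ
    refine Set.indicator_of_notMem (fun h => hσ ?_) _
    have h1 : z ∘ ⇑σ⁻¹ = (z ∘ Tuple.sort z) ∘ ⇑((Tuple.sort z)⁻¹ * σ⁻¹) := by
      funext i; simp
    have h2 := perm_eq_one_of_chamber h hτ h1
    rw [← mul_inv_rev, inv_eq_one] at h2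
    exact eq_inv_of_mul_eq_one_left h2
  · simp

/-- A sum over all lattice points, of a function vanishing at points with coinciding coordinates,
is a sum over the chamber and over permutations. -/
lemma hasSum_fold {f : (Fin N → ℤ) → ℝ} {s : ℝ} (hf : HasSum f s)
    (h0 : ∀ z, ¬ Function.Injective z → f z = 0) :
    HasSum ((Chamber N).indicator fun z => ∑ σ : Equiv.Perm (Fin N), f (z ∘ σ)) s := by
  have h1 : ∀ σ : Equiv.Perm (Fin N), HasSum (Set.indicator {z | z ∘ ⇑σ⁻¹ ∈ Chamber N} f)
      (∑' z, Set.indicator {z | z ∘ ⇑σ⁻¹ ∈ Chamber N} f z) := fun σ =>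
    (hf.summable.indicator _).hasSum
  have h2 := hasSum_sum (s := Finset.univ) fun σ _ => h1 σ
  have h3 : (fun z => ∑ σ : Equiv.Perm (Fin N),
      Set.indicator {z | z ∘ ⇑σ⁻¹ ∈ Chamber N} f z) = f := by
    funext z
    by_cases hz : Function.Injective z
    · exact sum_indicator_chamber hz (f z)
    · rw [h0 z hz]
      refine Finset.sum_eq_zero fun σ _ => ?_
      by_cases hm : z ∈ {z : Fin N → ℤ | z ∘ ⇑σ⁻¹ ∈ Chamber N}
      · rw [Set.indicator_of_mem hm, h0 z hz]
      · rw [Set.indicator_of_notMem hm]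
  rw [h3] at h2
  rw [hf.unique h2]
  have h4 : ∀ σ : Equiv.Perm (Fin N), HasSum ((Chamber N).indicator fun z => f (z ∘ σ))
      (∑' z, Set.indicator {z | z ∘ ⇑σ⁻¹ ∈ Chamber N} f z) := fun σ => by
    have := h1 σ
    rw [← (Equiv.arrowCongr σ⁻¹ (Equiv.refl ℤ)).hasSum_iff] at this
    convert! this using 1
    funext z
    have e : (Equiv.arrowCongr σ⁻¹ (Equiv.refl ℤ)) z = z ∘ ⇑σ := rfl
    have e2 : (z ∘ ⇑σ) ∘ ⇑σ⁻¹ = z := by funext i; simp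
    rw [Function.comp_apply, e]
    by_cases hz : z ∈ Chamber N
    · rw [Set.indicator_of_mem hz, Set.indicator_of_mem]
      simpa only [Set.mem_ofPred_eq, e2] using hz
    · rw [Set.indicator_of_notMem hz, Set.indicator_of_notMem]
      simpa only [Set.mem_ofPred_eq, e2] using hz
  have h5 := hasSum_sum (s := Finset.univ) fun σ _ => h4 σ
  convert! h5 using 2 with z
  by_cases hz : z ∈ Chamber N
  · simp [hz]
  · simp [hz]

lemma h_comp (z : Fin N → ℤ) (σ : Equiv.Perm (Fin N)) :
    h (z ∘ σ) = ((Equiv.Perm.sign σ : ℤ) : ℝ) * h z := by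
  rw [h, h, ← Matrix.det_permute]
  rfl

lemma h_eq_zero {z : Fin N → ℤ} (hz : ¬ Function.Injective z) : h z = 0 := by
  simp only [Function.Injective, not_forall] at hz
  obtain ⟨i, j, hij, hne⟩ := hz
  refine Matrix.det_zero_of_row_eq hne (funext fun k => ?_)
  simp [Matrix.vandermonde_apply, hij]

lemma integrable_h_pi (t : ℝ≥0) (x : Fin N → ℤ) :
    Integrable (h : (Fin N → ℤ) → ℝ) (Measure.pi fun j => stepLaw t (x j)) := by
  have e : (h : (Fin N → ℤ) → ℝ) = fun z => ∑ σ : Equiv.Perm (Fin N),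
      ((Equiv.Perm.sign σ : ℤ) : ℝ) * ∏ j, (z j : ℝ) ^ (σ⁻¹ j : ℕ) := by
    funext z
    rw [h, Matrix.det_apply]
    refine Finset.sum_congr rfl fun σ _ => ?_
    rw [Units.smul_def, zsmul_eq_mul, ← Equiv.prod_comp σ fun j => (z j : ℝ) ^ (σ⁻¹ j : ℕ)]
    simp [Matrix.vandermonde_apply]
  rw [e]
  refine integrable_finsetSum _ fun σ _ => Integrable.const_mul ?_ _
  refine Integrable.fintype_prod (f := fun j (n : ℤ) => (n : ℝ) ^ (σ⁻¹ j : ℕ)) fun j => ?_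
  have := (integrable_stepLaw t (ExpBdd.intCast.pow (σ⁻¹ j : ℕ)) (x j)).re
  refine this.congr (ae_of_all _ fun n => ?_)
  have : ((n : ℂ) ^ (σ⁻¹ j : ℕ)) = (((n : ℝ) ^ (σ⁻¹ j : ℕ) : ℝ) : ℂ) := by push_cast; rfl
  simp only [this]
  exact Complex.ofReal_re _

end Fold

/-! ### The noncolliding walk as a Markov chain -/

section Walk
variable {N : ℕ} {Ω Ω' : Type*} [MeasurableSpace Ω] [MeasurableSpace Ω']
  {P : (Fin N → ℤ) → Measure Ω} {V : ℝ≥0 → Ω → Fin N → ℤ} {u : Fin N → ℤ}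
  {Q : Measure Ω'} {X : ℝ≥0 → Ω' → Fin N → ℤ}

open Classical in
/-- Transition weights of the noncolliding walk, set to zero outside the chamber. -/
noncomputable def hKernel (t : ℝ≥0) (x y : Fin N → ℤ) : ℝ :=
  if x ∈ Chamber N ∧ y ∈ Chamber N then kmDet t x y * (h y / h x) else 0

lemma doobTransition_eq (hV : IsRandomWalkFamily P V) {x y : Fin N → ℤ}
    (hx : x ∈ Chamber N) (hy : y ∈ Chamber N) (t : ℝ≥0) :
    doobTransition P V t x y = hKernel t x y := by
  rw [doobTransition, hV.absorbedTransition_eq hx hy, hKernel, if_pos ⟨hx, hy⟩]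

lemma hKernel_nonneg (hV : IsRandomWalkFamily P V) (t : ℝ≥0) (x y : Fin N → ℤ) :
    0 ≤ hKernel t x y := by
  by_cases hxy : x ∈ Chamber N ∧ y ∈ Chamber N
  · rw [← doobTransition_eq hV hxy.1 hxy.2]
    exact mul_nonneg measureReal_nonneg (div_pos (h_pos hxy.2) (h_pos hxy.1)).le
  · rw [hKernel, if_neg hxy]

lemma IsNoncollidingWalk.isMarkovChain (hV : IsRandomWalkFamily P V) (hu : u ∈ Chamber N)
    (hX : IsNoncollidingWalk P V u Q X) :
    IsMarkovChain Q X u fun t x y => ENNReal.ofReal (hKernel t x y) := by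
  have := hX.prob
  refine ⟨hX.prob, hX.measurable, hX.start, fun n t x ht h0 hx => ?_⟩
  by_cases hall : ∀ i, x i ∈ Chamber N
  · have h1 := hX.finite_dim n t x ht h0 hx hall
    simp only [doobTransition_eq hV (hall _) (hall _)] at h1
    rw [← ENNReal.ofReal_prod_of_nonneg fun _ _ => hKernel_nonneg hV _ _ _, ← h1,
      ofReal_measureReal]
  · push Not at hall
    obtain ⟨i, hi⟩ := hall
    have hi0 : i ≠ 0 := fun h => hi (by rw [h, hx]; exact hu)
    obtain ⟨j, rfl⟩ := Fin.exists_succ_eq.2 hi0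
    rw [Finset.prod_eq_zero (Finset.mem_univ j)]
    · refine measure_mono_null ?_ hX.mem_chamber
      intro ω hω hcon
      refine hi ?_
      rw [← hω j.succ]
      exact hcon _
    · rw [hKernel, if_neg fun h => hi h.2, ENNReal.ofReal_zero]

/-! ### The determinantal identity on cylinder sets -/

lemma cylinder_insert {α : Type*} (Y : ℝ≥0 → α → Fin N → ℤ) (B : ℝ≥0 → Set (Fin N → ℤ)) (a : ℝ≥0)
    (I : Finset ℝ≥0) (z : Fin N → ℤ) [DecidableEq ℝ≥0] :
    ((⋂ r ∈ insert a I, Y r ⁻¹' B r) ∩ {ω | Y a ω = z})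
      = {_ω | z ∈ B a} ∩ ((⋂ r ∈ I, Y r ⁻¹' B r) ∩ {ω | Y a ω = z}) := by
  ext ω
  simp only [Finset.mem_insert, Set.iInter_iInter_eq_or_left, Set.mem_inter_iff, Set.mem_preimage,
    Set.mem_ofPred_eq]
  constructor
  · rintro ⟨⟨h1, h2⟩, rfl⟩
    exact ⟨h1, h2, rfl⟩
  · rintro ⟨h1, h2, rfl⟩
    exact ⟨⟨h1, h2⟩, rfl⟩

lemma real_cylinder_insert {α : Type*} [MeasurableSpace α] (μ : Measure α)
    (Y : ℝ≥0 → α → Fin N → ℤ) (B : ℝ≥0 → Set (Fin N → ℤ)) (a : ℝ≥0)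
    (I : Finset ℝ≥0) (z : Fin N → ℤ) [DecidableEq ℝ≥0] :
    μ.real ((⋂ r ∈ insert a I, Y r ⁻¹' B r) ∩ {ω | Y a ω = z})
      = (B a).indicator (fun z => μ.real ((⋂ r ∈ I, Y r ⁻¹' B r) ∩ {ω | Y a ω = z})) z := by
  rw [cylinder_insert]
  by_cases hz : z ∈ B a
  · rw [Set.indicator_of_mem hz]; simp [hz]
  · rw [Set.indicator_of_notMem hz]; simp [hz]

lemma measurableSet_cylinder {α : Type*} [MeasurableSpace α] {Y : ℝ≥0 → α → Fin N → ℤ}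
    (B : ℝ≥0 → Set (Fin N → ℤ)) {I : Finset ℝ≥0} {T : ℝ≥0} (hI : ∀ r ∈ I, r ≤ T) :
    MeasurableSet[IsMarkovChain.past Y T] (⋂ r ∈ I, Y r ⁻¹' B r) :=
  I.measurableSet_biInter fun r hr => IsMarkovChain.measurableSet_past (hI r hr) _

lemma IsNoncollidingWalk.real_notMem (hX : IsNoncollidingWalk P V u Q X) (A : Set Ω') (t : ℝ≥0)
    {z : Fin N → ℤ} (hz : z ∉ Chamber N) : Q.real (A ∩ {ω | X t ω = z}) = 0 := by
  rw [measureReal_def, measure_mono_null ?_ hX.mem_chamber, ENNReal.toReal_zero]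
  rintro ω ⟨-, hω⟩ hcon
  exact hz (hω ▸ hcon t)

/-- For events invariant under relabeling, the antisymmetrized law of the free walk is the law of
the noncolliding walk, up to the factor `h`. The induction is over the observation times: one step
sums over all positions of the free walk, and folding this sum onto the chamber produces the
Karlin–McGregor determinant. -/
lemma antisymm_cylinder (hV : IsRandomWalkFamily P V) (hu : u ∈ Chamber N)
    (hX : IsNoncollidingWalk P V u Q X) (B : ℝ≥0 → Set (Fin N → ℤ))
    (hB : ∀ r (σ : Equiv.Perm (Fin N)) y, y ∘ σ ∈ B r ↔ y ∈ B r) (I : Finset ℝ≥0) :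
    ∀ T : ℝ≥0, (∀ r ∈ I, r ≤ T) → ∀ y ∈ Chamber N,
      h y * ∑ σ : Equiv.Perm (Fin N), ((Equiv.Perm.sign σ : ℤ) : ℝ) *
          (P u).real ((⋂ r ∈ I, V r ⁻¹' B r) ∩ {ω | V T ω = y ∘ σ})
        = h u * Q.real ((⋂ r ∈ I, X r ⁻¹' B r) ∩ {ω | X T ω = y}) := by
  have hQ := hX.isMarkovChain hV hu
  induction I using Finset.induction_on_max with
  | empty =>
    intro T _ y hy
    simp only [Finset.notMem_empty, Set.iInter_of_empty, Set.iInter_univ, Set.univ_inter,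
      hV.real_apply_eq]
    rw [measureReal_def, hQ.apply_eq, ENNReal.toReal_ofReal (hKernel_nonneg hV _ _ _), hKernel,
      if_pos ⟨hu, hy⟩, kmDet]
    have := (h_pos hu).ne'
    field_simp
  | insert a I ha ih =>
    intro T hT y hy
    have haT : a ≤ T := hT a (Finset.mem_insert_self a I)
    have hle : ∀ r ∈ insert a I, r ≤ a := fun r hr => by
      rcases Finset.mem_insert.1 hr with rfl | hr
      exacts [le_rfl, (ha r hr).le]
    set α : (Fin N → ℤ) → ℝ := fun z => (P u).real ((⋂ r ∈ I, V r ⁻¹' B r) ∩ {ω | V a ω = z})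
    have h1 : ∀ σ : Equiv.Perm (Fin N), HasSum (fun z => ((Equiv.Perm.sign σ : ℤ) : ℝ) *
        ((B a).indicator α z * freeProb (T - a) z (y ∘ σ))) (((Equiv.Perm.sign σ : ℤ) : ℝ) *
          (P u).real ((⋂ r ∈ insert a I, V r ⁻¹' B r) ∩ {ω | V T ω = y ∘ σ})) := fun σ => by
      have := hV.hasSum_markov u haT (y ∘ σ) (measurableSet_cylinder B hle)
      simp only [real_cylinder_insert] at this
      exact this.mul_left _
    have h2 := hasSum_sum (s := Finset.univ) fun σ _ => h1 σ
    have e2 : (fun z => ∑ σ : Equiv.Perm (Fin N), ((Equiv.Perm.sign σ : ℤ) : ℝ) *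
        ((B a).indicator α z * freeProb (T - a) z (y ∘ σ)))
        = fun z => (B a).indicator α z * kmDet (T - a) z y := by
      funext z
      rw [kmDet, Finset.mul_sum]
      exact Finset.sum_congr rfl fun σ _ => by ring
    rw [e2] at h2
    -- The factor `kmDet (T - a) z y` is antisymmetric in `z`, so folding antisymmetrizes `α`.
    have h3 := (hasSum_fold h2 fun z hz => by
      rw [kmDet_eq_zero_left _ _ hz, mul_zero]).mul_left (h y)
    have h4 := (hQ.hasSum_markov haT y (measurableSet_cylinder B hle)).mul_left (h u)
    simp only [real_cylinder_insert, ENNReal.toReal_ofReal (hKernel_nonneg hV _ _ _)] at h4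
    refine h3.unique ?_
    convert! h4 using 2 with z
    by_cases hz : z ∈ Chamber N
    · rw [Set.indicator_of_mem hz]
      have e5 : ∀ σ : Equiv.Perm (Fin N), (B a).indicator α (z ∘ σ) * kmDet (T - a) (z ∘ σ) y
          = (B a).indicator (fun _ => kmDet (T - a) z y) z *
            (((Equiv.Perm.sign σ : ℤ) : ℝ) * α (z ∘ σ)) := fun σ => by
        rw [kmDet_comp_left]
        by_cases hzB : z ∈ B a
        · rw [Set.indicator_of_mem hzB, Set.indicator_of_mem ((hB a σ z).2 hzB)]; ring
        · rw [Set.indicator_of_notMem hzB, Set.indicator_of_notMem fun h => hzB ((hB a σ z).1 h)]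
          ring
      simp only [e5]
      rw [← Finset.mul_sum]
      have h6 := ih a (fun r hr => (ha r hr).le) z hz
      have hz0 := (h_pos hz).ne'
      rw [hKernel, if_pos ⟨hz, hy⟩]
      by_cases hzB : z ∈ B a
      · rw [Set.indicator_of_mem hzB, Set.indicator_of_mem hzB]
        field_simp
        linear_combination h y * kmDet (T - a) z y * h6
      · rw [Set.indicator_of_notMem hzB, Set.indicator_of_notMem hzB]
        ring
    · rw [Set.indicator_of_notMem hz, hKernel, if_neg fun h => hz h.1]
      ring

lemma IsRandomWalkFamily.integrable_h (hV : IsRandomWalkFamily P V) (x : Fin N → ℤ) (t : ℝ≥0) :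
    Integrable (fun ω => h (V t ω)) (P x) := by
  have h1 : Integrable (h : (Fin N → ℤ) → ℝ) ((P x).map (V t)) := by
    rw [hV.map_eq]
    exact integrable_h_pi t x
  exact h1.comp_measurable (hV.measurable t)

/-- The determinantal representation for events depending on finitely many configurations. -/
lemma setIntegral_h_cylinder (hV : IsRandomWalkFamily P V) (hu : u ∈ Chamber N)
    (hX : IsNoncollidingWalk P V u Q X) (B : ℝ≥0 → Set (Fin N → ℤ))
    (hB : ∀ r (σ : Equiv.Perm (Fin N)) y, y ∘ σ ∈ B r ↔ y ∈ B r) (I : Finset ℝ≥0)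
    {T : ℝ≥0} (hI : ∀ r ∈ I, r ≤ T) :
    ∫ ω in ⋂ r ∈ I, V r ⁻¹' B r, h (V T ω) ∂P u = h u * Q.real (⋂ r ∈ I, X r ⁻¹' B r) := by
  have := hV.prob u
  have := hX.prob
  have hQ := hX.isMarkovChain hV hu
  have hmV : ∀ z, MeasurableSet ((⋂ r ∈ I, V r ⁻¹' B r) ∩ {ω | V T ω = z}) := fun z =>
    (IsMarkovChain.past_le hV.measurable T _ (measurableSet_cylinder B hI)).inter
      (hV.measurable T (measurableSet_singleton z))
  have e : (⋂ r ∈ I, V r ⁻¹' B r) = ⋃ z, (⋂ r ∈ I, V r ⁻¹' B r) ∩ {ω | V T ω = z} := by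
    rw [← Set.inter_iUnion]
    refine (Set.inter_eq_left.2 fun ω _ => ?_).symm
    simp
  have h1 := hasSum_integral_iUnion hmV (f := fun ω => h (V T ω)) (μ := P u)
    (fun z z' hzz' => Set.disjoint_left.2 fun ω h h' => hzz' (h.2.symm.trans h'.2))
    (hV.integrable_h u T).integrableOn
  rw [← e] at h1
  have h2 : ∀ z, ∫ ω in (⋂ r ∈ I, V r ⁻¹' B r) ∩ {ω | V T ω = z}, h (V T ω) ∂P u
      = (P u).real ((⋂ r ∈ I, V r ⁻¹' B r) ∩ {ω | V T ω = z}) * h z := fun z => by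
    rw [← smul_eq_mul, ← setIntegral_const]
    refine setIntegral_congr_fun (hmV z) fun ω hω => ?_
    have : V T ω = z := hω.2
    simp only [this]
  simp only [h2] at h1
  have h3 := hasSum_fold h1 fun z hz => by rw [h_eq_zero hz, mul_zero]
  have hne : Q (⋂ r ∈ I, X r ⁻¹' B r) ≠ ∞ := measure_ne_top _ _
  have h5 := hQ.measure_eq_tsum T
    (IsMarkovChain.past_le hX.measurable T _ (measurableSet_cylinder B hI))
  have h6 : HasSum (fun z => Q.real ((⋂ r ∈ I, X r ⁻¹' B r) ∩ {ω | X T ω = z}))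
      (Q.real (⋂ r ∈ I, X r ⁻¹' B r)) := by
    rw [h5] at hne
    rw [measureReal_def, h5, ENNReal.tsum_toReal_eq fun z => ENNReal.ne_top_of_tsum_ne_top hne z]
    exact ENNReal.hasSum_toReal hne
  refine h3.unique ?_
  convert! h6.mul_left (h u) using 2 with z
  by_cases hz : z ∈ Chamber N
  · rw [Set.indicator_of_mem hz, ← antisymm_cylinder hV hu hX B hB I T hI z hz, Finset.mul_sum]
    refine Finset.sum_congr rfl fun σ _ => ?_
    rw [h_comp]; ring
  · rw [Set.indicator_of_notMem hz, hX.real_notMem _ _ hz, mul_zero]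

end Walk

/-! ### From cylinder sets to bounded functionals of the configuration path -/

section Config
variable {N : ℕ}

lemma config_comp (x : Fin N → ℤ) (σ : Equiv.Perm (Fin N)) : config (x ∘ σ) = config x :=
  Subtype.ext (Equiv.sum_comp σ fun j => Measure.dirac (x j))

lemma configSigma_le (t : ℝ≥0) :
    configSigma t ≤ (MeasurableSpace.pi : MeasurableSpace (ℝ≥0 → Config)) :=
  iSup₂_le fun s _ => (measurable_pi_apply s).comap_le

lemma measurable_configPath {α : Type*} [MeasurableSpace α] {Y : ℝ≥0 → α → Fin N → ℤ}
    (hY : ∀ t, Measurable (Y t)) : Measurable fun ω s => config (Y s ω) :=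
  measurable_pi_lambda _ fun s => (measurable_of_countable config).comp (hY s)

lemma preimage_configPath {α : Type*} (Y : ℝ≥0 → α → Fin N → ℤ) (I : Finset ℝ≥0)
    (C : ℝ≥0 → Set Config) : (fun ω s => config (Y s ω)) ⁻¹'
      (⋂ r ∈ I, (fun η : ℝ≥0 → Config => η r) ⁻¹' C r) = ⋂ r ∈ I, Y r ⁻¹' (config ⁻¹' C r) := by
  ext ω; simp

end Config

section Walk
variable {N : ℕ} {Ω Ω' : Type*} [MeasurableSpace Ω] [MeasurableSpace Ω']
  {P : (Fin N → ℤ) → Measure Ω} {V : ℝ≥0 → Ω → Fin N → ℤ} {u : Fin N → ℤ}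
  {Q : Measure Ω'} {X : ℝ≥0 → Ω' → Fin N → ℤ}

/-- The law of the noncolliding configuration path and the law of the free configuration path
weighted by `h (V T) / h u` agree on `𝓕(T)`. The weight is signed, so its negative part is moved to
the other side. -/
lemma trim_configPath_eq (hV : IsRandomWalkFamily P V) (hu : u ∈ Chamber N)
    (hX : IsNoncollidingWalk P V u Q X) (T : ℝ≥0) :
    (Q.map (fun ω s => config (X s ω)) + ((P u).withDensity fun ω =>
        ENNReal.ofReal (-(h (V T ω) / h u))).map
          (fun ω s => config (V s ω))).trim (configSigma_le T)
      = (((P u).withDensity fun ω => ENNReal.ofReal (h (V T ω) / h u)).map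
        (fun ω s => config (V s ω))).trim (configSigma_le T) := by
  have := hV.prob u
  have := hX.prob
  have hint : Integrable (fun ω => h (V T ω) / h u) (P u) := (hV.integrable_h u T).div_const _
  have hmV := measurable_configPath hV.measurable
  have hmX := measurable_configPath hX.measurable
  have hfin : ∀ f : Ω → ℝ, Integrable f (P u) → IsFiniteMeasure
      ((P u).withDensity fun ω => ENNReal.ofReal (f ω)) := fun f hf =>
    isFiniteMeasure_withDensity_ofReal hf.2
  have := hfin _ hint
  have := hfin _ hint.neg
  have hcyl : ∀ (I : Finset ℝ≥0), (∀ r ∈ I, r ≤ T) → ∀ C : ℝ≥0 → Set Config,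
      (∀ r, MeasurableSet (C r)) →
      (Q.map (fun ω s => config (X s ω)) + ((P u).withDensity fun ω =>
        ENNReal.ofReal (-(h (V T ω) / h u))).map (fun ω s => config (V s ω)))
          (⋂ r ∈ I, (fun η => η r) ⁻¹' C r)
      = (((P u).withDensity fun ω => ENNReal.ofReal (h (V T ω) / h u)).map
        (fun ω s => config (V s ω))) (⋂ r ∈ I, (fun η => η r) ⁻¹' C r) := by
    intro I hI C hC
    have hm : MeasurableSet (⋂ r ∈ I, (fun η : ℝ≥0 → Config => η r) ⁻¹' C r) :=
      I.measurableSet_biInter fun r _ => measurable_pi_apply r (hC r)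
    have hmc : MeasurableSet (⋂ r ∈ I, V r ⁻¹' (config ⁻¹' C r)) :=
      IsMarkovChain.past_le hV.measurable T _ (measurableSet_cylinder _ hI)
    have key := setIntegral_h_cylinder hV hu hX (fun r => config ⁻¹' C r)
      (fun r σ y => by simp only [Set.mem_preimage, config_comp]) I hI
    -- Positive and negative parts of the weight are the densities on the two sides.
    have key2 : ∫ ω in ⋂ r ∈ I, V r ⁻¹' (config ⁻¹' C r), h (V T ω) / h u ∂P u
        = Q.real (⋂ r ∈ I, X r ⁻¹' (config ⁻¹' C r)) := by
      rw [integral_div, key, mul_div_cancel_left₀ _ (h_pos hu).ne']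
    rw [integral_eq_lintegral_pos_part_sub_lintegral_neg_part hint.integrableOn,
      ← withDensity_apply _ hmc, ← withDensity_apply _ hmc, measureReal_def] at key2
    rw [Measure.add_apply, Measure.map_apply hmX hm, Measure.map_apply hmV hm,
      Measure.map_apply hmV hm, preimage_configPath, preimage_configPath]
    rw [← ENNReal.toReal_eq_toReal_iff' (by finiteness) (by finiteness),
      ENNReal.toReal_add (by finiteness) (by finiteness)]
    linarith
  refine ext_of_generate_finite
    (piiUnionInter (fun r => {A | MeasurableSet[MeasurableSpace.comap
      (fun η : ℝ≥0 → Config => η r) inferInstance] A}) {r | r ≤ T})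
    (generateFrom_piiUnionInter_measurableSet _ _).symm
    (isPiSystem_piiUnionInter _ (fun r => @MeasurableSpace.isPiSystem_measurableSet _ (_)) _) ?_ ?_
  · rintro _ ⟨I, hI, f, hf, rfl⟩
    have hf' : ∀ r, ∃ C : Set Config, MeasurableSet C ∧
        (r ∈ I → f r = (fun η : ℝ≥0 → Config => η r) ⁻¹' C) := fun r => by
      by_cases hr : r ∈ I
      · obtain ⟨C, hC, hfC⟩ := hf r hr
        exact ⟨C, hC, fun _ => hfC.symm⟩
      · exact ⟨∅, .empty, fun h => absurd h hr⟩
    choose C hC hfC using hf'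
    have e : (⋂ r ∈ I, f r) = ⋂ r ∈ I, (fun η : ℝ≥0 → Config => η r) ⁻¹' C r :=
      Set.iInter₂_congr hfC
    have hm : MeasurableSet[configSigma T] (⋂ r ∈ I, f r) :=
      measurableSet_iSup_of_mem_piiUnionInter _ _ _ ⟨I, hI, f, hf, rfl⟩
    rw [trim_measurableSet_eq _ hm, trim_measurableSet_eq _ hm, e]
    exact hcyl I (fun r hr => hI hr) C hC
  · rw [trim_measurableSet_eq _ .univ, trim_measurableSet_eq _ .univ]
    simpa using hcyl ∅ (by simp) (fun _ => ∅) fun _ => .empty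

/-- The noncolliding walk is the free walk reweighted by `h (V T) / h u`, as far as the
configuration path up to time `T` is concerned. -/
theorem integral_configPath_eq (hV : IsRandomWalkFamily P V) (hu : u ∈ Chamber N)
    (hX : IsNoncollidingWalk P V u Q X) {T : ℝ≥0} {F : (ℝ≥0 → Config) → ℂ}
    (hF : Measurable[configSigma T] F) {C : ℝ} (hC : ∀ η, ‖F η‖ ≤ C) :
    Integrable (fun ω => F (fun s => config (X s ω))) Q ∧
    Integrable (fun ω => F (fun s => config (V s ω)) * ((h (V T ω) / h u : ℝ) : ℂ)) (P u) ∧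
    ∫ ω, F (fun s => config (X s ω)) ∂Q
      = ∫ ω, F (fun s => config (V s ω)) * ((h (V T ω) / h u : ℝ) : ℂ) ∂P u := by
  have := hV.prob u
  have := hX.prob
  have hint : Integrable (fun ω => h (V T ω) / h u) (P u) := (hV.integrable_h u T).div_const _
  have hmV := measurable_configPath hV.measurable
  have hmX := measurable_configPath hX.measurable
  have hF' : Measurable F := hF.mono (configSigma_le T) le_rfl
  have hfin : ∀ f : Ω → ℝ, Integrable f (P u) → IsFiniteMeasure
      ((P u).withDensity fun ω => ENNReal.ofReal (f ω)) := fun f hf =>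
    isFiniteMeasure_withDensity_ofReal hf.2
  have := hfin _ hint
  have := hfin _ hint.neg
  have hbd : ∀ (μ : Measure (ℝ≥0 → Config)) [IsFiniteMeasure μ], Integrable F μ := fun μ _ =>
    Integrable.of_bound hF'.aestronglyMeasurable C (ae_of_all _ hC)
  have hmh : Measurable fun ω => h (V T ω) / h u :=
    ((measurable_of_countable h).comp (hV.measurable T)).div_const _
  have hI2 : ∀ f : Ω → ℝ, Integrable f (P u) →
      Integrable (fun ω => F (fun s => config (V s ω)) * ((f ω : ℝ) : ℂ)) (P u) := fun f hf =>
    (hf.ofReal (𝕜 := ℂ)).bdd_mul (hF'.comp hmV).aestronglyMeasurable (ae_of_all _ fun ω => hC _)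
  have hdens : ∀ f : Ω → ℝ, Measurable f →
      ∫ η, F η ∂(((P u).withDensity fun ω => ENNReal.ofReal (f ω)).map fun ω s => config (V s ω))
        = ∫ ω, F (fun s => config (V s ω)) * ((max (f ω) 0 : ℝ) : ℂ) ∂P u := fun f hf => by
    rw [integral_map hmV.aemeasurable hF'.aestronglyMeasurable,
      integral_withDensity_eq_integral_toReal_smul hf.ennreal_ofReal
        (ae_of_all _ fun ω => ENNReal.ofReal_lt_top)]
    refine integral_congr_ae (ae_of_all _ fun ω => ?_)
    simp only [ENNReal.toReal_ofReal', Complex.real_smul, mul_comm]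
  refine ⟨(hbd (Q.map _)).comp_measurable hmX, hI2 _ hint, ?_⟩
  have key := congrArg (fun μ => @integral _ _ _ _ (configSigma T) μ F)
    (trim_configPath_eq hV hu hX T)
  rw [← integral_trim _ hF.stronglyMeasurable, ← integral_trim _ hF.stronglyMeasurable,
    integral_add_measure (hbd _) (hbd _), hdens _ hmh, hdens (fun ω => -(h (V T ω) / h u)) hmh.neg,
    integral_map hmX.aemeasurable hF'.aestronglyMeasurable] at key
  rw [eq_sub_of_add_eq key, ← integral_sub (hI2 _ hint.pos_part) (hI2 _ hint.neg_part)]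
  refine integral_congr_ae (ae_of_all _ fun ω => ?_)
  simp only
  rw [← mul_sub, ← Complex.ofReal_sub, max_zero_sub_max_neg_zero_eq_self]

end Walk

end NoncollidingRW

theorem mainTheorem2 {N : ℕ} {Ω Ω' : Type*} [MeasurableSpace Ω] [MeasurableSpace Ω']
    (P : (Fin N → ℤ) → Measure Ω) (V : ℝ≥0 → Ω → Fin N → ℤ)
    (hV : NoncollidingRW.IsRandomWalkFamily P V)
    (u : Fin N → ℤ) (hu : u ∈ NoncollidingRW.Chamber N)
    (Q : Measure Ω') (X : ℝ≥0 → Ω' → Fin N → ℤ)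
    (hX : NoncollidingRW.IsNoncollidingWalk P V u Q X) :
    (∀ (k : Fin N) (t : ℝ≥0) (x : ℤ), Summable (fun w : ℤ =>
      (NoncollidingRW.besselI (w - x).natAbs (-(t : ℝ)) : ℂ) *
        NoncollidingRW.Phi u k (w : ℂ))) ∧
    NoncollidingRW.SatisfiesM P V hV.measurable u (NoncollidingRW.M u) ∧
    ∀ t T : ℝ≥0, t ≤ T → ∀ F : (ℝ≥0 → NoncollidingRW.Config) → ℂ,
      Measurable[NoncollidingRW.configSigma t] F → (∃ C : ℝ, ∀ η, ‖F η‖ ≤ C) →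
      Integrable (fun ω => F (fun s => NoncollidingRW.config (X s ω))) Q ∧
      Integrable (fun ω => F (fun s => NoncollidingRW.config (V s ω)) *
        (Matrix.of fun j k : Fin N => NoncollidingRW.M u k T (V T ω j)).det) (P u) ∧
      ∫ ω, F (fun s => NoncollidingRW.config (X s ω)) ∂Q =
        ∫ ω, F (fun s => NoncollidingRW.config (V s ω)) *
          (Matrix.of fun j k : Fin N => NoncollidingRW.M u k T (V T ω j)).det ∂(P u) := by
  refine ⟨NoncollidingRW.summable_M u, hV.satisfiesM u hu, fun t T htT F hF hFb => ?_⟩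
  obtain ⟨C, hC⟩ := hFb
  have hF' : Measurable[NoncollidingRW.configSigma T] F :=
    hF.mono (biSup_mono fun r hr => hr.trans htT) le_rfl
  simp only [NoncollidingRW.det_M hu]
  exact NoncollidingRW.integral_configPath_eq hV hu hX hF' hC
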